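/- **Conventions.** Let $X$ be a finite graph on $N$ vertices (undirected, no loops or multiple edges) with adjacency matrix $d$. A matrix $u=(u_{ij})$ over a unital $*$-algebra is *magic* if its entries are projections ($p^2=p=p^*$) which sum to $1$ on each row and on each column. The quantum automorphism group $G^+(X)$ is given by the universal unital C$^*$-algebra $C(G^+(X))$ generated by the entries of a magic $N\times N$ matrix $u$ with $du=ud$. For a finite quantum group $G$, with finite-dimensional C$^*$-algebra $C(G)$ and comultiplication $\Delta$, an embedding $G\subset S_N^+$ is a magic matrix $u\in M_N(C(G))$ whose entries generate $C(G)$ and such that $\Delta(u_{ij})=\sum_k u_{ik}\otimes u_{kj}$; it acts on $X$ if $du=ud$. One writes $G=G^+(X)$ if there is an embedding $v$ of $G$ such that the $*$-algebras generated by the entries of $v$ and of the fundamental magic matrix $u$ of $C(G^+(X))$ are isomorphic via $u_{ij}\mapsto v_{ij}$; $G$ has the *Frucht property* if $G=G^+(X)$ for some finite graph $X$. The *orbitals* of $G\subset S_N^+$ are the classes of the relation $(i,k)\sim(j,l)\iff u_{ij}u_{kl}\neq0$. The *classical version* of $G$ is the group of characters of $C(G)$ with product $(\varphi\otimes\psi)\Delta$.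 The Kac–Paljutkin quantum group $G_0$ of order $8$ has $C(G_0)=\mathbb C f_1\oplus\mathbb C f_2\oplus\mathbb C f_3\oplus\mathbb C f_4\oplus M_2(\mathbb C)$, with matrix units $E_{kl}$ in $M_2(\mathbb C)$, and comultiplication $$\begin{aligned} \Delta(f_1)&=\textstyle\sum_i f_i\otimes f_i+\tfrac12\sum_{k,l}E_{kl}\otimes E_{kl},\\ \Delta(f_2)&=f_1\otimes f_2+f_2\otimes f_1+f_3\otimes f_4+f_4\otimes f_3+\tfrac12(E_{11}\otimes E_{22}+E_{22}\otimes E_{11})+\tfrac i2(E_{21}\otimes E_{12}-E_{12}\otimes E_{21}),\\ \Delta(f_3)&=f_1\otimes f_3+f_3\otimes f_1+f_2\otimes f_4+f_4\otimes f_2+\tfrac12(E_{11}\otimes E_{22}+E_{22}\otimes E_{11})-\tfrac i2(E_{21}\otimes E_{12}-E_{12}\otimes E_{21}),\\ \Delta(f_4)&=f_1\otimes f_4+f_4\otimes f_1+f_2\otimes f_3+f_3\otimes f_2+\tfrac12(E_{11}\otimes E_{11}+E_{22}\otimes E_{22}-E_{12}\otimes E_{12}-E_{21}\otimes E_{21}),\\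 \Delta(E_{11})&=(f_1+f_4)\otimes E_{11}+E_{11}\otimes(f_1+f_4)+(f_2+f_3)\otimes E_{22}+E_{22}\otimes(f_2+f_3),\\ \Delta(E_{22})&=(f_1+f_4)\otimes E_{22}+E_{22}\otimes(f_1+f_4)+(f_2+f_3)\otimes E_{11}+E_{11}\otimes(f_2+f_3),\\ \Delta(E_{12})&=(f_1-f_4)\otimes E_{12}+E_{12}\otimes(f_1-f_4)+i\big((f_2-f_3)\otimes E_{21}-E_{21}\otimes(f_2-f_3)\big),\\ \Delta(E_{21})&=(f_1-f_4)\otimes E_{21}+E_{21}\otimes(f_1-f_4)-i\big((f_2-f_3)\otimes E_{12}-E_{12}\otimes(f_2-f_3)\big). \end{aligned}$$ With $I_2$ the unit of $M_2(\mathbb C)$, $p=\frac12\begin{pmatrix}1&e^{-i\pi/4}\\e^{i\pi/4}&1\end{pmatrix}$, $a=f_1+f_4$, $b=f_2+f_3$, consider the magic matrices $$u^{G_0}=\begin{pmatrix}f_1+f_2&f_3+f_4&p&I_2-p\\f_3+f_4&f_1+f_2&I_2-p&p\\p^T&I_2-p^T&f_1+f_3&f_2+f_4\\I_2-p^T&p^T&f_2+f_4&f_1+f_3\end{pmatrix},\quad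 w=\begin{pmatrix}a&b&E_{11}&E_{22}\\b&a&E_{22}&E_{11}\\E_{11}&E_{22}&a&b\\E_{22}&E_{11}&b&a\end{pmatrix},$$ and $x,y,z$, of the form $\begin{pmatrix}q&1-q\\1-q&q\end{pmatrix}$ with $q=f_1+f_2+f_3+f_4$, $q=a+E_{11}$, $q=a+E_{22}$ respectively. Let $$D_4=\{e,(12),(34),(12)(34),(13)(24),(14)(23),(1324),(1423)\}\subset S_4,$$ and for $\omega\in D_4$ let $b_1(\omega)=1$ if $\omega$ exchanges $\{1,2\}$ and $\{3,4\}$, and $b_1(\omega)=0$ otherwise. **Theorem.** The Kac–Paljutkin quantum group $G_0$ does not have the Frucht property: there is no finite graph $X$ with $G^+(X)=G_0$. More precisely: 1. For every embedding $G_0\subset S_N^+$ the vertices can be relabelled so that $u$ is block diagonal with blocks from $u^{G_0},w,x,y,z,1$, where $u^{G_0}$ occurs. Let $\omega\in D_4$ (a group isomorphic to the dihedral group of order $8$) act on each block of type $u^{G_0}$ as $\omega$, on blocks of type $w$ as $[(13)(24)]^{b_1(\omega)}$, on blocks of type $x$ and $z$ as $(12)^{b_1(\omega)}$, and trivially on blocks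 of type $y$ and $1$. This is an injective group homomorphism from $D_4$ to the permutations of the vertices, each of its values maps every orbital onto itself, and if $G_0$ acts on a graph $X$ via this embedding, then each of its values is an automorphism of $X$; thus $D_4\subset G(X)$. 2. The classical version of $G_0$ is isomorphic to $\mathbb Z_2\times\mathbb Z_2$. -/

import Mathlib

open scoped TensorProduct

/-! ## Magic unitaries, and the quantum automorphism group of a finite graph -/

namespace QuantumAut

open scoped ENNReal CStarAlgebra

section Graph

variable {V : Type*} [Fintype V]

/-- A magic unitary: a square matrix of projections (`p * p = p` and `star p = p`), which sum to
`1` on each row and on each column. -/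
structure IsMagic {A : Type*} [Ring A] [StarRing A] (u : Matrix V V A) : Prop where
  proj : ∀ i j, IsStarProjection (u i j)
  row : ∀ i, ∑ j, u i j = 1
  col : ∀ j, ∑ i, u i j = 1

open Classical in
/-- `d u = u d`, where `d` is the adjacency matrix of the graph `X`. -/
def Preserves {A : Type*} [Ring A] (u : Matrix V V A) (X : SimpleGraph V) : Prop :=
  X.adjMatrix A * u = u * X.adjMatrix A

/-- The set of matrix entries. -/
def entries {A : Type*} (u : Matrix V V A) : Set A := Set.range fun ij : V × V => u ij.1 ij.2

/-- A representation, in some unital C⋆-algebra, of the relations "`v` is magic and `d v = v d`". -/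
structure GraphModel (X : SimpleGraph V) where
  B : Type
  [cstar : CStarAlgebra B]
  [nontriv : Nontrivial B]
  v : Matrix V V B
  magic : IsMagic v
  preserves : Preserves v X

attribute [instance] GraphModel.cstar GraphModel.nontriv

noncomputable section

/-- The C⋆-algebra of all bounded families indexed by the representations of the relations. -/
abbrev BigProduct (X : SimpleGraph V) : Type _ := lp (fun m : GraphModel X => m.B) ∞

instance (X : SimpleGraph V) : CStarAlgebra (BigProduct X) where

/-- The `(i, j)` entries of all representations of the relations at once. -/
def coordinate (X : SimpleGraph V) (i j : V) : BigProduct X :=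
  ⟨fun m => m.v i j, memℓp_infty ⟨1, by rintro _ ⟨m, rfl⟩; exact (m.magic.proj i j).norm_le⟩⟩

/-- `C(G⁺(X))`, the universal C⋆-algebra generated by the entries of a magic unitary `u` with
`d u = u d`, in other words the quotient of `C(S_N⁺)` by the relations `d u = u d`. It is realised as the C⋆-algebra generated by the universal representation of these
relations. Its universal property is `existsUnique_hom` below. -/
def QAutAlg (X : SimpleGraph V) : StarSubalgebra ℂ (BigProduct X) :=
  (StarAlgebra.adjoin ℂ (Set.range fun ij : V × V => coordinate X ij.1 ij.2)).topologicalClosure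

instance (X : SimpleGraph V) : CStarAlgebra (QAutAlg X) :=
  haveI : IsClosed (QAutAlg X : Set (BigProduct X)) := StarSubalgebra.isClosed_topologicalClosure _
  inferInstance

/-- The fundamental magic unitary `u` of `C(G⁺(X))`. -/
def fund (X : SimpleGraph V) : Matrix V V (QAutAlg X) := Matrix.of fun i j =>
  ⟨coordinate X i j, StarSubalgebra.le_topologicalClosure _
    (StarAlgebra.subset_adjoin ℂ _ ⟨(i, j), rfl⟩)⟩

/-- Evaluation of a bounded family at one representation of the relations. -/
def evalHom (X : SimpleGraph V) (m : GraphModel X) : BigProduct X →⋆ₐ[ℂ] m.B where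
  toFun a := a m
  map_one' := rfl
  map_mul' _ _ := rfl
  map_zero' := rfl
  map_add' _ _ := rfl
  commutes' _ := rfl
  map_star' _ := rfl

theorem fund_isMagic (X : SimpleGraph V) : IsMagic (fund X) where
  proj i j := ⟨Subtype.ext (lp.ext (funext fun m => (m.magic.proj i j).isIdempotentElem)),
    Subtype.ext (lp.ext (funext fun m => (m.magic.proj i j).isSelfAdjoint))⟩
  row i := Subtype.ext (lp.ext (funext fun m => by
    change (evalHom X m) (((QAutAlg X).subtype) (∑ j, fund X i j)) = 1
    rw [map_sum, map_sum]
    exact m.magic.row i))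
  col j := Subtype.ext (lp.ext (funext fun m => by
    change (evalHom X m) (((QAutAlg X).subtype) (∑ i, fund X i j)) = 1
    rw [map_sum, map_sum]
    exact m.magic.col j))

theorem fund_preserves (X : SimpleGraph V) : Preserves (fund X) X := by
  classical
  refine Matrix.ext fun i j => Subtype.ext (lp.ext (funext fun m => ?_))
  have h := congrFun (congrFun m.preserves i) j
  change (evalHom X m) (((QAutAlg X).subtype) ((X.adjMatrix (QAutAlg X) * fund X) i j))
    = (evalHom X m) (((QAutAlg X).subtype) ((fund X * X.adjMatrix (QAutAlg X)) i j))
  simp only [Matrix.mul_apply, map_sum, map_mul, SimpleGraph.adjMatrix_apply,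
    apply_ite (evalHom X m), apply_ite (QAutAlg X).subtype, map_one, map_zero] at h ⊢
  exact h

/-- The universal property of `C(G⁺(X))`. -/
theorem existsUnique_hom (X : SimpleGraph V) (B : Type) [CStarAlgebra B] [Nontrivial B]
    (v : Matrix V V B) (hv : IsMagic v) (hX : Preserves v X) :
    ∃! φ : QAutAlg X →⋆ₐ[ℂ] B, ∀ i j, φ (fund X i j) = v i j := by
  have key : ∀ φ ψ : QAutAlg X →⋆ₐ[ℂ] B, (∀ i j, φ (fund X i j) = ψ (fund X i j)) → φ = ψ := by
    intro φ ψ h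
    have hφ : Continuous φ := map_continuous φ
    have hψ : Continuous ψ := map_continuous ψ
    refine StarAlgHom.ext_topologicalClosure hφ hψ (StarAlgHom.ext_adjoin ?_)
    rintro ⟨_, hx⟩ ⟨⟨i, j⟩, rfl⟩
    exact h i j
  exact ⟨(evalHom X ⟨B, v, hv, hX⟩).comp (QAutAlg X).subtype, fun _ _ => rfl,
    fun φ hφ => key _ _ hφ⟩

end

end Graph

section Rep

variable {V : Type*} [Fintype V]
variable {A : Type*} [Ring A] [StarRing A] [Algebra ℂ A] [StarModule ℂ A] [Coalgebra ℂ A]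

/-- An embedding `G ⊂ S_N⁺` of the finite quantum group `G` with (finite-dimensional) algebra of
functions `A = C(G)`: a magic unitary with `Δ(u_{ij}) = ∑ₖ u_{ik} ⊗ u_{kj}` whose entries
generate `A`. That `ε(u_{ij}) = δ_{ij}` and `S(u_{ij}) = star u_{ji}` follows. -/
structure IsFundamentalMagicRep (u : Matrix V V A) : Prop where
  magic : IsMagic u
  comul : ∀ i j, Coalgebra.comul (R := ℂ) (u i j) = ∑ k, u i k ⊗ₜ[ℂ] u k j
  generates : StarAlgebra.adjoin ℂ (entries u) = ⊤

/-- The identification `(A, u) = (B, v)` of Woronowicz algebras: the ⋆-algebras generated by the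
entries are isomorphic, via `u_{ij} ↦ v_{ij}`. -/
def SameWoronowicz {B C : Type*} [Ring B] [StarRing B] [Algebra ℂ B] [StarModule ℂ B]
    [Ring C] [StarRing C] [Algebra ℂ C] [StarModule ℂ C]
    (u : Matrix V V B) (v : Matrix V V C) : Prop :=
  ∃ φ : StarAlgebra.adjoin ℂ (entries u) ≃⋆ₐ[ℂ] StarAlgebra.adjoin ℂ (entries v),
    ∀ i j, (φ ⟨u i j, StarAlgebra.subset_adjoin ℂ _ ⟨(i, j), rfl⟩⟩ : C) = v i j

variable (A) in
/-- The Frucht property of the finite quantum group `G` with `C(G) = A`: there is a finite graph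
`X` with `G = G⁺(X)`. That is, `G` has a fundamental representation `v`, necessarily magic, such
that `(C(G), v)` and `C(G⁺(X))`, with its fundamental magic unitary, are the same. -/
def HasFruchtProperty : Prop :=
  ∃ (N : ℕ) (X : SimpleGraph (Fin N)) (v : Matrix (Fin N) (Fin N) A),
    IsFundamentalMagicRep v ∧ SameWoronowicz (fund X) v

/-- The relation `(i, k) ∼ (j, l) ↔ u_{ij} u_{kl} ≠ 0`. -/
def OrbitalRel (u : Matrix V V A) (a b : V × V) : Prop := u a.1 b.1 * u a.2 b.2 ≠ 0

/-- Orbitals are the classes of the relation `OrbitalRel u`. -/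
def IsOrbital (u : Matrix V V A) (o : Set (V × V)) : Prop :=
  ∃ a : V × V, o = {b | OrbitalRel u a b}

end Rep

/-- The classical version of a finite quantum group with `C(G) = A`: the Gelfand spectrum of the
abelianisation of `A`, that is, the set of all characters of `A` (these vanish on the commutator
ideal, and preserve `star`), with multiplication `φ ψ = (φ ⊗ ψ) Δ`. -/
abbrev ClassicalVersion (A : Type*) [Ring A] [Bialgebra ℂ A] : Type _ := WithConv (A →ₐ[ℂ] ℂ)

end QuantumAut

/-! ## The Kac–Paljutkin quantum group -/

namespace KacPaljutkin

/-- The algebra of functions `C(G₀) = ℂ ⊕ ℂ ⊕ ℂ ⊕ ℂ ⊕ M₂(ℂ)`. -/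
def KP : Type := (Fin 4 → ℂ) × Matrix (Fin 2) (Fin 2) ℂ

noncomputable section

instance : Ring KP :=
  inferInstanceAs (Ring ((Fin 4 → ℂ) × Matrix (Fin 2) (Fin 2) ℂ))
instance : StarRing KP :=
  inferInstanceAs (StarRing ((Fin 4 → ℂ) × Matrix (Fin 2) (Fin 2) ℂ))
instance : Algebra ℂ KP :=
  inferInstanceAs (Algebra ℂ ((Fin 4 → ℂ) × Matrix (Fin 2) (Fin 2) ℂ))
instance : StarModule ℂ KP :=
  inferInstanceAs (StarModule ℂ ((Fin 4 → ℂ) × Matrix (Fin 2) (Fin 2) ℂ))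

open scoped Matrix.Norms.L2Operator in
/-- `C(G₀)` is a C⋆-algebra. The norm plays no role in what follows. -/
abbrev cstarAlgebra : CStarAlgebra KP :=
  inferInstanceAs (CStarAlgebra ((Fin 4 → ℂ) × Matrix (Fin 2) (Fin 2) ℂ))

namespace KP

@[ext] theorem ext {a b : KP} (h₁ : ∀ i, a.1 i = b.1 i) (h₂ : ∀ k l, a.2 k l = b.2 k l) : a = b :=
  Prod.ext (funext h₁) (Matrix.ext h₂)
@[simp] theorem fst_add (a b : KP) : (a + b).1 = a.1 + b.1 := rfl
@[simp] theorem snd_add (a b : KP) : (a + b).2 = a.2 + b.2 := rfl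
@[simp] theorem fst_mul (a b : KP) : (a * b).1 = a.1 * b.1 := rfl
@[simp] theorem snd_mul (a b : KP) : (a * b).2 = a.2 * b.2 := rfl
@[simp] theorem fst_smul (c : ℂ) (a : KP) : (c • a).1 = c • a.1 := rfl
@[simp] theorem snd_smul (c : ℂ) (a : KP) : (c • a).2 = c • a.2 := rfl
@[simp] theorem fst_one : (1 : KP).1 = 1 := rfl
@[simp] theorem snd_one : (1 : KP).2 = 1 := rfl
@[simp] theorem fst_zero : (0 : KP).1 = 0 := rfl
@[simp] theorem snd_zero : (0 : KP).2 = 0 := rfl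
@[simp] theorem fst_star (a : KP) : (star a).1 = star a.1 := rfl
@[simp] theorem snd_star (a : KP) : (star a).2 = star a.2 := rfl

end KP

/-- The unit of the `i`-th copy of `ℂ`; with indices starting at `0`. -/
def f (i : Fin 4) : KP := (Pi.single i 1, 0)

/-- The matrix units of the summand `M₂(ℂ)`. -/
def E (k l : Fin 2) : KP := (0, Matrix.single k l 1)


/-- The element of `C(G₀)` given by a matrix in the summand `M₂(ℂ)`. -/
def ofMat (m : Matrix (Fin 2) (Fin 2) ℂ) : KP := (0, m)

@[simp] theorem f_fst (i : Fin 4) : (f i).1 = Pi.single i 1 := rfl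
@[simp] theorem f_snd (i : Fin 4) : (f i).2 = 0 := rfl
@[simp] theorem E_fst (k l : Fin 2) : (E k l).1 = 0 := rfl
@[simp] theorem E_snd (k l : Fin 2) : (E k l).2 = Matrix.single k l 1 := rfl

theorem eq_sum (a : KP) : a = ∑ i, a.1 i • f i + ∑ k, ∑ l, a.2 k l • E k l := by
  ext i j
  · fin_cases i <;> simp [Fin.sum_univ_four]
  · fin_cases i <;> fin_cases j <;> simp [Fin.sum_univ_four]

theorem linearMap_ext {M : Type*} [AddCommMonoid M] [Module ℂ M] {φ ψ : KP →ₗ[ℂ] M}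
    (hf : ∀ i, φ (f i) = ψ (f i)) (hE : ∀ k l, φ (E k l) = ψ (E k l)) : φ = ψ := by
  refine LinearMap.ext fun a => ?_
  rw [eq_sum a]
  simp only [map_add, map_sum, map_smul, hf, hE]

theorem one_eq : (1 : KP) = f 0 + f 1 + f 2 + f 3 + E 0 0 + E 1 1 := by
  ext i j
  · fin_cases i <;> simp
  · fin_cases i <;> fin_cases j <;> simp

theorem f_mul_f (i j : Fin 4) : f i * f j = if i = j then f i else 0 := by
  ext k l
  · split_ifs <;> simp [Pi.single_apply] <;> grind
  · split_ifs <;> simp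
theorem f_mul_E (i : Fin 4) (k l : Fin 2) : f i * E k l = 0 := by ext <;> simp
theorem E_mul_f (i : Fin 4) (k l : Fin 2) : E k l * f i = 0 := by ext <;> simp
theorem E_mul_E (k l m n : Fin 2) : E k l * E m n = if l = m then E k n else 0 := by
  split_ifs with h
  · subst h; ext <;> simp
  · ext <;> simp [h]

open Complex (I)

/-- The elements `Δ(fᵢ)`. -/
def comulF : Fin 4 → KP ⊗[ℂ] KP :=
  ![f 0 ⊗ₜ f 0 + f 1 ⊗ₜ f 1 + f 2 ⊗ₜ f 2 + f 3 ⊗ₜ f 3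
      + (1 / 2 : ℂ) • (E 0 0 ⊗ₜ E 0 0 + E 0 1 ⊗ₜ E 0 1 + E 1 0 ⊗ₜ E 1 0 + E 1 1 ⊗ₜ E 1 1),
    f 0 ⊗ₜ f 1 + f 1 ⊗ₜ f 0 + f 2 ⊗ₜ f 3 + f 3 ⊗ₜ f 2
      + (1 / 2 : ℂ) • (E 0 0 ⊗ₜ E 1 1 + E 1 1 ⊗ₜ E 0 0)
      + (I / 2) • (E 1 0 ⊗ₜ E 0 1 - E 0 1 ⊗ₜ E 1 0),
    f 0 ⊗ₜ f 2 + f 2 ⊗ₜ f 0 + f 1 ⊗ₜ f 3 + f 3 ⊗ₜ f 1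
      + (1 / 2 : ℂ) • (E 0 0 ⊗ₜ E 1 1 + E 1 1 ⊗ₜ E 0 0)
      - (I / 2) • (E 1 0 ⊗ₜ E 0 1 - E 0 1 ⊗ₜ E 1 0),
    f 0 ⊗ₜ f 3 + f 3 ⊗ₜ f 0 + f 1 ⊗ₜ f 2 + f 2 ⊗ₜ f 1
      + (1 / 2 : ℂ) • (E 0 0 ⊗ₜ E 0 0 + E 1 1 ⊗ₜ E 1 1 - E 0 1 ⊗ₜ E 0 1 - E 1 0 ⊗ₜ E 1 0)]

/-- The elements `Δ(E_{kl})`. -/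
def comulE : Matrix (Fin 2) (Fin 2) (KP ⊗[ℂ] KP) :=
  !![(f 0 + f 3) ⊗ₜ E 0 0 + E 0 0 ⊗ₜ (f 0 + f 3) + (f 1 + f 2) ⊗ₜ E 1 1 + E 1 1 ⊗ₜ (f 1 + f 2),
    (f 0 - f 3) ⊗ₜ E 0 1 + E 0 1 ⊗ₜ (f 0 - f 3)
      + I • ((f 1 - f 2) ⊗ₜ E 1 0 - E 1 0 ⊗ₜ (f 1 - f 2));
    (f 0 - f 3) ⊗ₜ E 1 0 + E 1 0 ⊗ₜ (f 0 - f 3)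
      - I • ((f 1 - f 2) ⊗ₜ E 0 1 - E 0 1 ⊗ₜ (f 1 - f 2)),
    (f 0 + f 3) ⊗ₜ E 1 1 + E 1 1 ⊗ₜ (f 0 + f 3) + (f 1 + f 2) ⊗ₜ E 0 0 + E 0 0 ⊗ₜ (f 1 + f 2)]

/-- The comultiplication. -/
def comulMap : KP →ₗ[ℂ] KP ⊗[ℂ] KP where
  toFun a := ∑ i, a.1 i • comulF i + ∑ k, ∑ l, a.2 k l • comulE k l
  map_add' a b := by
    simp only [KP.fst_add, KP.snd_add, Pi.add_apply, Matrix.add_apply, add_smul,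
      Finset.sum_add_distrib]
    abel
  map_smul' c a := by
    simp only [KP.fst_smul, KP.snd_smul, Pi.smul_apply, Matrix.smul_apply, smul_assoc,
      Finset.smul_sum, smul_add, RingHom.id_apply]

@[simp] theorem comulMap_f (i : Fin 4) : comulMap (f i) = comulF i := by
  fin_cases i <;> simp [comulMap, Fin.sum_univ_four]
@[simp] theorem comulMap_E (k l : Fin 2) : comulMap (E k l) = comulE k l := by
  fin_cases k <;> fin_cases l <;> simp [comulMap]

/-- The counit: `ε(f₀) = 1`, and zero on the other basis elements. -/
def counitMap : KP →ₗ[ℂ] ℂ where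
  toFun a := a.1 0
  map_add' _ _ := rfl
  map_smul' _ _ := rfl

/-- The antipode: `S(fᵢ) = fᵢ`, and `S(E_{kl}) = E_{lk}`. -/
def antipodeMap : KP →ₗ[ℂ] KP where
  toFun a := (a.1, a.2.transpose)
  map_add' _ _ := rfl
  map_smul' _ _ := rfl




theorem smul_mul' (r : ℂ) (x y : KP ⊗[ℂ] KP) : (r • x) * y = r • (x * y) := smul_mul_assoc r x y
theorem mul_smul' (r : ℂ) (x y : KP ⊗[ℂ] KP) : x * (r • y) = r • (x * y) := mul_smul_comm r x y


@[simp] theorem antipodeMap_f (i : Fin 4) : antipodeMap (f i) = f i :=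
  KP.ext (fun _ => rfl) fun _ _ => rfl
@[simp] theorem antipodeMap_E (k l : Fin 2) : antipodeMap (E k l) = E l k :=
  KP.ext (fun _ => rfl) fun i j => congrFun (congrFun (Matrix.transpose_single k l 1) i) j
@[simp] theorem counitMap_f (i : Fin 4) : counitMap (f i) = if i = 0 then 1 else 0 := by
  change (Pi.single i 1 : Fin 4 → ℂ) 0 = _
  simp [Pi.single_apply, eq_comm]
@[simp] theorem counitMap_E (k l : Fin 2) : counitMap (E k l) = 0 := rfl

open TensorProduct Algebra.TensorProduct

set_option maxHeartbeats 1000000 in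
theorem comulF_mul_comulF (i j : Fin 4) :
    comulF i * comulF j = if i = j then comulF i else 0 := by
  fin_cases i <;> fin_cases j <;>
  · simp only [comulF, Matrix.cons_val, Fin.isValue, Fin.mk_one, Fin.zero_eta,
      Fin.reduceFinMk, add_mul, mul_add, sub_mul, mul_sub, smul_mul', mul_smul',
      tmul_mul_tmul, f_mul_f, f_mul_E, E_mul_f, E_mul_E, Fin.reduceEq, if_true, if_false,
      zero_tmul, tmul_zero, smul_zero, add_zero, zero_add, sub_zero, zero_sub,
      zero_ne_one, one_ne_zero, smul_add, smul_sub]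
    try (match_scalars <;> first | ring1 | (ring_nf; norm_num [Complex.I_sq]))

set_option maxHeartbeats 1000000 in
theorem comulE_mul_comulE (k l m n : Fin 2) :
    comulE k l * comulE m n = if l = m then comulE k n else 0 := by
  fin_cases k <;> fin_cases l <;> fin_cases m <;> fin_cases n <;>
  · simp only [comulE, Matrix.cons_val, Matrix.of_apply, Fin.isValue, Fin.mk_one,
      Fin.zero_eta, add_mul, mul_add, sub_mul, mul_sub, smul_mul', mul_smul',
      tmul_mul_tmul, f_mul_f, f_mul_E, E_mul_f, E_mul_E, Fin.reduceEq, if_true, if_false,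
      zero_tmul, tmul_zero, smul_zero, add_zero, zero_add, sub_zero, zero_sub,
      zero_ne_one, one_ne_zero, smul_sub, add_tmul, sub_tmul, tmul_add, tmul_sub]
    try (match_scalars <;> first | ring1 | (ring_nf; norm_num [Complex.I_sq]))

theorem comul_sum_eq_one : (∑ i, comulF i) + ∑ k, comulE k k = 1 := by
  simp only [Algebra.TensorProduct.one_def, one_eq, comulF, comulE, Fin.sum_univ_four,
    Fin.sum_univ_two, Matrix.cons_val, Matrix.of_apply, Fin.isValue, add_tmul, tmul_add, smul_add,
    smul_sub]
  module

theorem comulMap_one : comulMap 1 = 1 := by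
  rw [← comul_sum_eq_one, one_eq]
  simp only [map_add, comulMap_f, comulMap_E, Fin.sum_univ_four, Fin.sum_univ_two]
  abel

theorem comulF_mul_comulE (i : Fin 4) (m n : Fin 2) : comulF i * comulE m n = 0 := by
  have h₁ : (∑ i, comulF i) * comulE m n = 0 := by
    have h := congrArg (· * comulE m n) comul_sum_eq_one
    fin_cases m <;> simpa [add_mul, Finset.sum_mul, comulE_mul_comulE] using h
  have h₂ : comulF i * ∑ j, comulF j = comulF i := by
    simp [Finset.mul_sum, comulF_mul_comulF]
  rw [← h₂, mul_assoc, h₁, mul_zero]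

theorem comulE_mul_comulF (i : Fin 4) (m n : Fin 2) : comulE m n * comulF i = 0 := by
  have h₁ : comulE m n * (∑ i, comulF i) = 0 := by
    have h := congrArg (comulE m n * ·) comul_sum_eq_one
    fin_cases n <;> simpa [mul_add, Finset.mul_sum, comulE_mul_comulE] using h
  have h₂ : (∑ j, comulF j) * comulF i = comulF i := by
    simp [Finset.sum_mul, comulF_mul_comulF]
  rw [← h₂, ← mul_assoc, h₁, zero_mul]

theorem comulMap_mul (a b : KP) : comulMap (a * b) = comulMap a * comulMap b := by
  have h : (LinearMap.mul ℂ KP).compr₂ comulMap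
      = (LinearMap.mul ℂ (KP ⊗[ℂ] KP)).compl₁₂ comulMap comulMap := by
    refine linearMap_ext (fun i => linearMap_ext (fun j => ?_) fun m n => ?_)
      (fun k l => linearMap_ext (fun j => ?_) fun m n => ?_) <;>
    simp only [LinearMap.compr₂_apply, LinearMap.compl₁₂_apply, LinearMap.mul_apply', comulMap_f,
      comulMap_E, comulF_mul_comulF, comulF_mul_comulE, comulE_mul_comulF, comulE_mul_comulE,
      f_mul_f, f_mul_E, E_mul_f, E_mul_E, map_zero] <;>
    split_ifs <;> simp
  exact LinearMap.congr_fun₂ h a b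

set_option maxRecDepth 4000 in
set_option maxHeartbeats 4000000 in
theorem comulMap_coassoc : (TensorProduct.assoc ℂ KP KP KP).toLinearMap ∘ₗ
    comulMap.rTensor KP ∘ₗ comulMap = comulMap.lTensor KP ∘ₗ comulMap := by
  refine linearMap_ext (fun i => ?_) (fun i j => ?_)
  · fin_cases i <;>
    · simp only [LinearMap.comp_apply, LinearEquiv.coe_coe, comulMap_f, comulMap_E, comulF, comulE,
        Matrix.cons_val, Matrix.of_apply, Fin.isValue, Fin.mk_one, Fin.zero_eta, Fin.reduceFinMk,
        map_add, map_sub, map_smul, LinearMap.rTensor_tmul, LinearMap.lTensor_tmul, add_tmul,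
        sub_tmul, tmul_add, tmul_sub, tmul_smul, ← smul_tmul', TensorProduct.assoc_tmul, smul_add, smul_sub]
      match_scalars <;> first | ring1 | (ring_nf; norm_num [Complex.I_sq])
  · fin_cases i <;> fin_cases j <;>
    · simp only [LinearMap.comp_apply, LinearEquiv.coe_coe, comulMap_f, comulMap_E, comulF, comulE,
        Matrix.cons_val, Matrix.of_apply, Fin.isValue, Fin.mk_one, Fin.zero_eta,
        map_add, map_sub, map_smul, LinearMap.rTensor_tmul, LinearMap.lTensor_tmul, add_tmul,
        sub_tmul, tmul_add, tmul_sub, tmul_smul, ← smul_tmul', TensorProduct.assoc_tmul, smul_add, smul_sub]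
      match_scalars <;> first | ring1 | (ring_nf; norm_num [Complex.I_sq])

theorem star_f (i : Fin 4) : star (f i) = f i := by
  ext j
  · fin_cases i <;> fin_cases j <;> simp
  · simp

theorem star_E (k l : Fin 2) : star (E k l) = E l k := by
  ext i j
  · simp
  · fin_cases k <;> fin_cases l <;> fin_cases i <;> fin_cases j <;> simp [Matrix.star_apply]

theorem comulMap_star (a : KP) : comulMap (star a) = star (comulMap a) := by
  have hF : ∀ i, star (comulF i) = comulF i := by
    intro i
    fin_cases i <;> simp [comulF, star_f, star_E, neg_div] <;> module
  have hE : ∀ k l, star (comulE k l) = comulE l k := by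
    intro k l
    fin_cases k <;> fin_cases l <;> simp [comulE, star_f, star_E]
    all_goals module
  simp only [comulMap, LinearMap.coe_mk, AddHom.coe_mk, star_add, star_sum, star_smul, hF, hE]
  rw [Finset.sum_comm (s := (Finset.univ : Finset (Fin 2)))]
  rfl

instance : HopfAlgebra ℂ KP where
  comul := comulMap
  counit := counitMap
  coassoc := comulMap_coassoc
  rTensor_counit_comp_comul := by
    refine linearMap_ext (fun i => ?_) (fun i j => ?_)
    · fin_cases i <;> simp [comulF, smul_tmul']
    · fin_cases i <;> fin_cases j <;> simp [comulE]
  lTensor_counit_comp_comul := by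
    refine linearMap_ext (fun i => ?_) (fun i j => ?_)
    · fin_cases i <;> simp [comulF]
    · fin_cases i <;> fin_cases j <;> simp [comulE]
  counit_one := rfl
  mul_compr₂_counit := rfl
  comul_one := comulMap_one
  mul_compr₂_comul := LinearMap.ext₂ comulMap_mul
  antipode := antipodeMap
  mul_antipode_rTensor_comul := by
    refine linearMap_ext (fun i => ?_) (fun i j => ?_)
    · fin_cases i <;> simp [comulF, f_mul_f, E_mul_E,
        Algebra.algebraMap_eq_smul_one, one_eq]
      all_goals module
    · fin_cases i <;> fin_cases j <;> simp [comulE, mul_add, add_mul, sub_mul,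
        mul_sub, f_mul_E, E_mul_f]
  mul_antipode_lTensor_comul := by
    refine linearMap_ext (fun i => ?_) (fun i j => ?_)
    · fin_cases i <;> simp [comulF, f_mul_f, E_mul_E,
        Algebra.algebraMap_eq_smul_one, one_eq]
      all_goals module
    · fin_cases i <;> fin_cases j <;> simp [comulE, mul_add, add_mul, sub_mul,
        mul_sub, f_mul_E, E_mul_f]

/-! ### The transitive magic representations -/

/-- The rank one projection used in `repU`. -/
def p : Matrix (Fin 2) (Fin 2) ℂ :=
  !![1 / 2, 1 / 2 * Complex.exp (-(Real.pi / 4 * I)); 1 / 2 * Complex.exp (Real.pi / 4 * I), 1 / 2]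

open Matrix in
/-- The fundamental magic representation `u^{G₀}`, which gives `G₀ ⊂ S₄⁺`. -/
def repU : Matrix (Fin 4) (Fin 4) KP :=
  !![f 0 + f 1, f 2 + f 3, ofMat p, ofMat (1 - p);
    f 2 + f 3, f 0 + f 1, ofMat (1 - p), ofMat p;
    ofMat pᵀ, ofMat (1 - pᵀ), f 0 + f 2, f 1 + f 3;
    ofMat (1 - pᵀ), ofMat pᵀ, f 1 + f 3, f 0 + f 2]

/-- The magic representation `w`. -/
def repW : Matrix (Fin 4) (Fin 4) KP :=
  !![f 0 + f 3, f 1 + f 2, E 0 0, E 1 1;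
    f 1 + f 2, f 0 + f 3, E 1 1, E 0 0;
    E 0 0, E 1 1, f 0 + f 3, f 1 + f 2;
    E 1 1, E 0 0, f 1 + f 2, f 0 + f 3]

/-- The magic representation `x`. -/
def repX : Matrix (Fin 2) (Fin 2) KP :=
  !![f 0 + f 1 + f 2 + f 3, ofMat 1; ofMat 1, f 0 + f 1 + f 2 + f 3]

/-- The magic representation `y`. -/
def repY : Matrix (Fin 2) (Fin 2) KP :=
  !![f 0 + f 3 + E 0 0, f 1 + f 2 + E 1 1; f 1 + f 2 + E 1 1, f 0 + f 3 + E 0 0]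

/-- The magic representation `z`. -/
def repZ : Matrix (Fin 2) (Fin 2) KP :=
  !![f 0 + f 3 + E 1 1, f 1 + f 2 + E 0 0; f 1 + f 2 + E 0 0, f 0 + f 3 + E 1 1]

/-- The types of blocks: one for each of `u^{G₀}`, `w`, `x`, `y`, `z` and the trivial
representation `1`. -/
inductive BlockType
  | u | w | x | y | z | one

/-- The number of vertices in a block. -/
def BlockType.size : BlockType → ℕ
  | .u => 4
  | .w => 4
  | .x => 2
  | .y => 2
  | .z => 2
  | .one => 1

/-- The magic representation of a block. -/
def BlockType.rep : (b : BlockType) → Matrix (Fin b.size) (Fin b.size) KP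
  | .u => repU
  | .w => repW
  | .x => repX
  | .y => repY
  | .z => repZ
  | .one => 1

/-- A relabelling of the vertices which turns `u` into the block diagonal matrix whose blocks are
`u^{G₀}`, `w`, `x`, `y`, `z`, `1`, with multiplicities. -/
structure BlockLabelling {V : Type*} (u : Matrix V V KP) where
  /-- The number of blocks. -/
  k : ℕ
  /-- The type of each block. -/
  type : Fin k → BlockType
  /-- The relabelling. -/
  label : V ≃ (q : Fin k) × Fin (type q).size
  eq_blockDiagonal : u = (Matrix.blockDiagonal' fun q => (type q).rep).submatrix label label

end

/-! ### The action of `D₄` -/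

open Equiv in
/-- The copy `{e, (12), (34), (12)(34), (13)(24), (14)(23), (1324), (1423)}` of `D₄`, on the points
`0, 1, 2, 3` instead of `1, 2, 3, 4`. -/
def d4List : List (Perm (Fin 4)) :=
  [1, swap 0 1, swap 2 3, swap 0 1 * swap 2 3, swap 0 2 * swap 1 3, swap 0 3 * swap 1 2,
    c[0, 2, 1, 3], c[0, 3, 1, 2]]

/-- `D₄` as a subgroup of `S₄`. -/
def D4 : Subgroup (Equiv.Perm (Fin 4)) where
  carrier := {ω | ω ∈ d4List}
  mul_mem' {a b} ha hb :=
    (by decide : ∀ a ∈ d4List, ∀ b ∈ d4List, a * b ∈ d4List) a ha b hb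
  one_mem' := by simp [d4List]
  inv_mem' {a} ha := (by decide : ∀ a ∈ d4List, a⁻¹ ∈ d4List) a ha

/-- The exponent `b₁` in `ω = (34)^{b₃} (12)^{b₂} s^{b₁}`, where `s = (14)(23)`, is `1` if and only
if `ω` exchanges the sets `{1, 2}` and `{3, 4}`. -/
def crosses (ω : Equiv.Perm (Fin 4)) : Bool := decide (2 ≤ (ω 0).val)

theorem crosses_mul : ∀ a ∈ d4List, ∀ b ∈ d4List, crosses (a * b) = xor (crosses a) (crosses b) := by
  decide

/-- The action of `D₄` through `ω ↦ τ ^ b₁`, for an involution `τ`. -/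
def crossHom {n : ℕ} (τ : Equiv.Perm (Fin n)) (hτ : τ * τ = 1) : D4 →* Equiv.Perm (Fin n) where
  toFun ω := if crosses ω.1 then τ else 1
  map_one' := by simp [crosses]
  map_mul' a b := by
    change (if crosses (a.1 * b.1) = true then τ else 1) = _
    rw [crosses_mul a.1 a.2 b.1 b.2]
    cases crosses a.1 <;> cases crosses b.1 <;> simp [hτ]

open Equiv in
/-- The action of `D₄` on a block: the given one on blocks of type `u^{G₀}`, `(13)(24)^{b₁}` on
blocks of type `w`, `(12)^{b₁}` on blocks of type `x` and `z`, and trivial on the others. -/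
def BlockType.action : (b : BlockType) → D4 →* Perm (Fin b.size)
  | .u => D4.subtype
  | .w => crossHom (n := 4) (swap 0 2 * swap 1 3) (by decide)
  | .x => crossHom (n := 2) (swap 0 1) (by decide)
  | .y => 1
  | .z => crossHom (n := 2) (swap 0 1) (by decide)
  | .one => 1

/-- The action of `D₄` on the vertices, block by block. -/
def BlockLabelling.action {V : Type*} {u : Matrix V V KP} (L : BlockLabelling u) :
    D4 →* Equiv.Perm V where
  toFun ω := (L.label.trans (Equiv.sigmaCongrRight fun q => (L.type q).action ω)).trans L.label.symm
  map_one' := by ext v; simp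
  map_mul' a b := by ext v; simp [Equiv.Perm.mul_apply]

end KacPaljutkin

namespace KacPaljutkin

open QuantumAut

/-! The obstruction is that `G₀` has too few classical points. Whenever `G₀` acts on a graph `X`, a
copy of `D₄` permutes the vertices and preserves all orbitals
(`BlockLabelling.mul_action_eq_zero_iff`). Adjacency is constant on orbitals (`IsMagicRep.adj_iff`),
so `D₄ ⊂ G(X)`. If `G₀ = G⁺(X)`, universality would turn the eight elements of `D₄` into eight
distinct characters of `C(G₀)` (`exists_algHom_of_sameWoronowicz`); but there are only four, one for
each one-dimensional summand.

Orbitals are read off from the Haar functional `h`. It is a faithful trace, so for projections `ab =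
0` if and only if `h(ab) = 0`. The entries of all transitive magic representations have integer
coordinates in one basis orthonormal for `8 h(ab)`, and each `ω ∈ D₄` moves the columns of all
blocks by one and the same isometry of `ℤ⁸`. Having a single isometry is essential, since an orbital
may involve entries from two different blocks.

The transitive representations are classified as follows. By invariance of `h`, all entries of such
a representation on `n` points have Haar measure `1/n`, and integrality of `8h` on diagonal entries
gives `n ∣ 8`. The case `n = 8` would leave nothing on `M₂(ℂ)`. For `n = 2, 4`, comparing
coefficients in `Δ(u_ii) = ∑ₖ u_ik ⊗ u_ki` yields quadratic equations that determine the parts in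
`M₂(ℂ)` up to complement. A block of type `u` must occur because the entries of the other types lie
in a proper subalgebra; on it `D₄` acts faithfully. -/

/-- The isomorphism between the dihedral group of order `8` and `D4`. -/
def dihedralToD4 : DihedralGroup 4 → D4
  | .r i => ⟨c[0, 2, 1, 3] ^ i.val, D4.pow_mem (by change _ ∈ d4List; decide) _⟩
  | .sr i => ⟨Equiv.swap 0 1 * c[0, 2, 1, 3] ^ i.val,
      D4.mul_mem (by change _ ∈ d4List; decide) (D4.pow_mem (by change _ ∈ d4List; decide) _)⟩

theorem nonempty_d4_mulEquiv_dihedralGroup : Nonempty (D4 ≃* DihedralGroup 4) := by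
  let φ : DihedralGroup 4 →* D4 := MonoidHom.mk' dihedralToD4 fun a b => by
    revert a b
    decide
  refine ⟨(MulEquiv.ofBijective φ ⟨?_, ?_⟩).symm⟩
  · change Function.Injective dihedralToD4
    decide
  · change Function.Surjective dihedralToD4
    rintro ⟨ω, hω⟩
    have h : ∀ ω ∈ d4List, ∃ g, (dihedralToD4 g).1 = ω := by decide
    obtain ⟨g, hg⟩ := h ω hω
    exact ⟨g, Subtype.ext hg⟩

noncomputable section

/-! ### Characters of `C(G₀)` and the classical version -/

/-- The character of `C(G₀)` given by the `i`-th copy of `ℂ`. -/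
def character (i : Fin 4) : KP →ₐ[ℂ] ℂ where
  toFun a := a.1 i
  map_one' := rfl
  map_mul' _ _ := rfl
  map_zero' := rfl
  map_add' _ _ := rfl
  commutes' _ := rfl

theorem character_f (i j : Fin 4) : character i (f j) = if i = j then 1 else 0 := by
  change (Pi.single j 1 : Fin 4 → ℂ) i = _
  simp [Pi.single_apply]

theorem character_E (i : Fin 4) (k l : Fin 2) : character i (E k l) = 0 := rfl

theorem character_injective : Function.Injective character := by
  intro i j h
  have := DFunLike.congr_fun h (f i)
  rw [character_f, character_f] at this
  by_contra hij
  simp [Ne.symm hij] at this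

/-- Off-diagonal matrix units have square zero, so every character kills them; a diagonal one is a
product of two off-diagonal ones. -/
theorem algHom_E (χ : KP →ₐ[ℂ] ℂ) (k l : Fin 2) : χ (E k l) = 0 := by
  have h₁ : ∀ m n, m ≠ n → χ (E m n) = 0 := fun m n h => by
    have := map_mul χ (E m n) (E m n)
    rw [E_mul_E, if_neg h.symm, map_zero] at this
    exact mul_self_eq_zero.mp this.symm
  by_cases h : k = l
  · obtain ⟨m, hm⟩ : ∃ m, m ≠ k := exists_ne k
    have := map_mul χ (E k m) (E m k)
    rw [E_mul_E, if_pos rfl, h₁ m k hm, mul_zero] at this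
    rwa [← h]
  · exact h₁ k l h

/-- Since the matrix units are killed, the orthogonal idempotents `f i` have values summing to `1`:
exactly one of them is sent to `1`, and this one determines the character. -/
theorem character_surjective : Function.Surjective character := by
  intro χ
  have h1 : χ (f 0) + χ (f 1) + χ (f 2) + χ (f 3) = 1 := by
    have := map_one χ
    rw [one_eq] at this
    simpa only [map_add, algHom_E, add_zero] using this
  obtain ⟨i, hi⟩ : ∃ i, χ (f i) ≠ 0 := by
    by_contra! h
    simp [h] at h1
  have hi1 : χ (f i) = 1 := by
    have := map_mul χ (f i) (f i)
    rw [f_mul_f, if_pos rfl] at this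
    exact mul_left_cancel₀ hi (by rw [← this, mul_one])
  refine ⟨i, AlgHom.toLinearMap_injective (linearMap_ext (fun j => ?_) fun k l => ?_)⟩
  · change character i (f j) = χ (f j)
    rw [character_f]
    split_ifs with h
    · rw [← h, hi1]
    · have := map_mul χ (f i) (f j)
      rw [f_mul_f, if_neg h, map_zero, hi1, one_mul] at this
      exact this
  · exact (algHom_E χ k l).symm

theorem natCard_classicalVersion : Nat.card (ClassicalVersion KP) = 4 := by
  rw [Nat.card_congr (WithConv.equiv _), ← Nat.card_congr
    (Equiv.ofBijective _ ⟨character_injective, character_surjective⟩), Nat.card_fin]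

theorem algHom_ext {χ ψ : KP →ₐ[ℂ] ℂ} (h : ∀ i, χ (f i) = ψ (f i)) : χ = ψ :=
  AlgHom.toLinearMap_injective
    (linearMap_ext h fun k l => (algHom_E χ k l).trans (algHom_E ψ k l).symm)

theorem classicalVersion_mul_self (χ : ClassicalVersion KP) : χ * χ = 1 := by
  obtain ⟨i, hi⟩ := character_surjective χ.ofConv
  refine WithConv.ofConv_injective (algHom_ext fun j => ?_)
  refine (AlgHom.convMul_apply χ χ (f j)).trans (.trans ?_ (AlgHom.convOne_apply (f j)).symm)
  rw [← hi, show Coalgebra.comul (R := ℂ) (f j) = comulF j from comulMap_f j,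
    show Coalgebra.counit (R := ℂ) (f j) = _ from counitMap_f j]
  -- Among the `Δ(f j)`, only `Δ(f 0)` contains terms `f i ⊗ f i`, and it contains all of them.
  fin_cases i <;> fin_cases j <;> simp [comulF, character_f, character_E]

theorem nonempty_classicalVersion_mulEquiv :
    Nonempty (ClassicalVersion KP ≃* Multiplicative (ZMod 2 × ZMod 2)) := by
  let : Group (ClassicalVersion KP) :=
    { (inferInstance : Monoid (ClassicalVersion KP)) with
      inv := id
      inv_mul_cancel := classicalVersion_mul_self }
  have : IsKleinFour (ClassicalVersion KP) := ⟨natCard_classicalVersion, by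
    refine Nat.Prime.eq_one_or_self_of_dvd Nat.prime_two _
      (Monoid.exponent_dvd_of_forall_pow_eq_one fun χ => ?_) |>.resolve_left fun h => ?_
    · rw [pow_two]
      exact classicalVersion_mul_self χ
    · have := Monoid.exp_eq_one_iff.mp h
      have h4 := natCard_classicalVersion
      rw [Nat.card_unique] at h4
      omega⟩
  obtain ⟨e⟩ := IsKleinFour.nonempty_mulEquiv (G₁ := ClassicalVersion KP)
    (G₂ := Multiplicative (ZMod 2 × ZMod 2))
  exact ⟨e⟩

/-! ### The Haar functional -/

/-- The Haar functional of `G₀`. -/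
def haar : KP →ₗ[ℂ] ℂ where
  toFun a := (∑ i, a.1 i) / 8 + a.2.trace / 4
  map_add' a b := by simp [Finset.sum_add_distrib]; ring
  map_smul' c a := by simp [← Finset.mul_sum]; ring

theorem haar_apply (a : KP) : haar a = (∑ i, a.1 i) / 8 + a.2.trace / 4 := rfl

theorem haar_f (i : Fin 4) : haar (f i) = 1 / 8 := by simp [haar_apply]

theorem haar_E (k l : Fin 2) : haar (E k l) = if k = l then 1 / 4 else 0 := by
  fin_cases k <;> fin_cases l <;> simp [haar_apply, Matrix.trace]

theorem haar_one : haar 1 = 1 := by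
  simp [haar_apply]; norm_num

theorem haar_mul_comm (a b : KP) : haar (a * b) = haar (b * a) := by
  simp only [haar_apply, KP.fst_mul, KP.snd_mul, mul_comm a.1, Matrix.trace_mul_comm a.2]

theorem haar_antipodeMap (a : KP) : haar (antipodeMap a) = haar a :=
  congrArg (fun t => (∑ i, a.1 i) / 8 + t / 4) (Matrix.trace_transpose a.2)

/-- A weighted sum of squared absolute values of all coordinates, which makes `haar` both positive
and faithful. -/
theorem haar_star_mul_self (a : KP) :
    haar (star a * a) =
      (((∑ i, Complex.normSq (a.1 i)) / 8 + (∑ k, ∑ l, Complex.normSq (a.2 k l)) / 4 : ℝ) : ℂ) := by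
  simp only [haar_apply, KP.fst_mul, KP.snd_mul, KP.fst_star, KP.snd_star, Matrix.trace_fin_two,
    Matrix.mul_apply, Matrix.star_apply, Pi.mul_apply, Pi.star_apply, Fin.sum_univ_two,
    Fin.sum_univ_four]
  push_cast [Complex.normSq_eq_conj_mul_self]
  simp only [Complex.star_def]
  ring

theorem haar_star_mul_self_re_nonneg (a : KP) : 0 ≤ (haar (star a * a)).re := by
  rw [haar_star_mul_self, Complex.ofReal_re]
  have h₁ := Finset.sum_nonneg fun i (_ : i ∈ Finset.univ) => Complex.normSq_nonneg (a.1 i)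
  have h₂ := Finset.sum_nonneg fun k (_ : k ∈ Finset.univ) =>
    Finset.sum_nonneg fun l (_ : l ∈ Finset.univ) => Complex.normSq_nonneg (a.2 k l)
  linarith

theorem eq_zero_of_haar_star_mul_self_re {a : KP} (h : (haar (star a * a)).re = 0) : a = 0 := by
  rw [haar_star_mul_self, Complex.ofReal_re] at h
  have h₁ := Finset.sum_nonneg fun i (_ : i ∈ Finset.univ) => Complex.normSq_nonneg (a.1 i)
  have h₂ := Finset.sum_nonneg fun k (_ : k ∈ Finset.univ) =>
    Finset.sum_nonneg fun l (_ : l ∈ Finset.univ) => Complex.normSq_nonneg (a.2 k l)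
  have h₃ : ∑ i, Complex.normSq (a.1 i) = 0 := by linarith
  have h₄ : ∑ k, ∑ l, Complex.normSq (a.2 k l) = 0 := by linarith
  simp only [Fin.sum_univ_two, Fin.sum_univ_four] at h₃ h₄
  have n (z : ℂ) := Complex.normSq_nonneg z
  ext i j
  · apply Complex.normSq_eq_zero.mp
    have := n (a.1 0); have := n (a.1 1); have := n (a.1 2); have := n (a.1 3)
    fin_cases i <;> dsimp <;> linarith
  · apply Complex.normSq_eq_zero.mp
    have := n (a.2 0 0); have := n (a.2 0 1); have := n (a.2 1 0); have := n (a.2 1 1)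
    fin_cases i <;> fin_cases j <;> dsimp <;> linarith

/-- By traciality `h((ab)* ab) = h(bab) = h(ab)`, and `h` is faithful. This turns the orbital
relation into a condition on scalars. -/
theorem mul_eq_zero_iff_haar {a b : KP} (ha : IsStarProjection a) (hb : IsStarProjection b) :
    a * b = 0 ↔ haar (a * b) = 0 := by
  refine ⟨fun h => by rw [h, map_zero], fun h => eq_zero_of_haar_star_mul_self_re ?_⟩
  rw [star_mul, ha.isSelfAdjoint.star_eq, hb.isSelfAdjoint.star_eq, mul_assoc, ← mul_assoc a,
    ha.isIdempotentElem.eq, haar_mul_comm, mul_assoc, hb.isIdempotentElem.eq, h, Complex.zero_re]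

theorem eq_zero_iff_haar {a : KP} (ha : IsStarProjection a) : a = 0 ↔ haar a = 0 := by
  simpa only [ha.isIdempotentElem.eq] using mul_eq_zero_iff_haar ha ha

/-- Projections which sum to `1` are pairwise orthogonal. -/
theorem mul_eq_zero_of_sum_eq_one {ι : Type*} [Fintype ι] {q : ι → KP}
    (hq : ∀ i, IsStarProjection (q i)) (h1 : ∑ i, q i = 1) {i j : ι} (hij : i ≠ j) :
    q i * q j = 0 := by
  classical
  -- Compressing `∑ q k = 1` by `q j` gives `∑ q j * q k * q j = q j`. The terms with `k ≠ j` sum to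
  -- zero, and each has nonnegative Haar value.
  have key : ∑ k ∈ Finset.univ.erase j, (haar (star (q k * q j) * (q k * q j))).re = 0 := by
    have h : ∀ k, star (q k * q j) * (q k * q j) = q j * q k * q j := fun k => by
      rw [star_mul, (hq k).isSelfAdjoint.star_eq, (hq j).isSelfAdjoint.star_eq, mul_assoc,
        ← mul_assoc (q k), (hq k).isIdempotentElem.eq, mul_assoc]
    have h₂ : ∑ k, q j * q k * q j = q j := by
      rw [← Finset.sum_mul, ← Finset.mul_sum, h1, mul_one, (hq j).isIdempotentElem.eq]
    rw [← Finset.add_sum_erase _ _ (Finset.mem_univ j), (hq j).isIdempotentElem.eq,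
      (hq j).isIdempotentElem.eq, add_eq_left] at h₂
    simp only [h]
    rw [← Complex.re_sum, ← map_sum, h₂, map_zero, Complex.zero_re]
  rw [Finset.sum_eq_zero_iff_of_nonneg fun k _ => haar_star_mul_self_re_nonneg _] at key
  exact eq_zero_of_haar_star_mul_self_re (key i (by simp [hij]))

/-- Invariance of the Haar functional. -/
theorem haar_invariant (a : KP) :
    TensorProduct.rid ℂ KP (haar.lTensor KP (comulMap a)) = haar a • 1 := by
  have hf : ∀ i, TensorProduct.rid ℂ KP (haar.lTensor KP (comulMap (f i))) = haar (f i) • 1 := by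
    intro i
    fin_cases i <;> simp [comulF, haar_f, haar_E, one_eq] <;> module
  have hE : ∀ k l,
      TensorProduct.rid ℂ KP (haar.lTensor KP (comulMap (E k l))) = haar (E k l) • 1 := by
    intro k l
    fin_cases k <;> fin_cases l <;> simp [comulE, haar_f, haar_E, one_eq] <;> module
  rw [eq_sum a]
  simp only [map_add, map_sum, map_smul, hf, hE, add_smul, Finset.sum_smul, smul_assoc]

/-! ### Magic representations -/

/-- A magic representation of `G₀`, not necessarily faithful. -/
structure IsMagicRep {V : Type*} [Fintype V] (u : Matrix V V KP) : Prop where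
  magic : IsMagic u
  comul : ∀ i j, comulMap (u i j) = ∑ k, u i k ⊗ₜ[ℂ] u k j

namespace IsMagicRep

variable {V : Type*} [Fintype V] {u : Matrix V V KP}

theorem row_orthogonal (hu : IsMagicRep u) (i : V) {j k : V} (h : j ≠ k) : u i j * u i k = 0 :=
  mul_eq_zero_of_sum_eq_one (hu.magic.proj i) (hu.magic.row i) h

theorem col_orthogonal (hu : IsMagicRep u) (k : V) {i j : V} (h : i ≠ j) : u i k * u j k = 0 :=
  mul_eq_zero_of_sum_eq_one (fun i => hu.magic.proj i k) (hu.magic.col k) h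

/-- If `ε(u_ij) = 1`, then column orthogonality kills the other `ε(u_kj)`, and applying `id ⊗ ε` to
`Δ(u_mj)` shows that columns `i` and `j` coincide. As `u_ii` and `u_ij` are orthogonal, `u_ij` would
vanish. -/
theorem counit_eq_zero (hu : IsMagicRep u) {i j : V} (h : i ≠ j) : (u i j).1 0 = 0 := by
  by_contra hij
  have h01 : (u i j).1 0 = 1 := by
    have := congrFun (congrArg Prod.fst (hu.magic.proj i j).isIdempotentElem.eq) 0
    exact mul_left_cancel₀ hij (by rw [mul_one]; exact this)
  have hk : ∀ k ≠ i, (u k j).1 0 = 0 := fun k hk => by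
    have := congrFun (congrArg Prod.fst (hu.col_orthogonal j hk)) 0
    have h' : (u k j).1 0 * (u i j).1 0 = 0 := this
    rwa [h01, mul_one] at h'
  have key : ∀ m, u m j = u m i := fun m => by
    have h₁ := congrArg (fun t => TensorProduct.rid ℂ KP (counitMap.lTensor KP t)) (hu.comul m j)
    have h₂ : TensorProduct.rid ℂ KP (counitMap.lTensor KP (comulMap (u m j))) = u m j := by
      have := Coalgebra.lTensor_counit_comul (R := ℂ) (u m j)
      change counitMap.lTensor KP (comulMap (u m j)) = _ at this
      rw [this]
      simp
    simp only [h₂, map_sum, LinearMap.lTensor_tmul, TensorProduct.rid_tmul] at h₁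
    rw [h₁, Finset.sum_eq_single i]
    · change (u i j).1 0 • u m i = _
      rw [h01, one_smul]
    · intro k _ hki
      change (u k j).1 0 • u m k = _
      rw [hk k hki, zero_smul]
    · simp
  have := hu.row_orthogonal i h
  rw [← key, (hu.magic.proj i j).isIdempotentElem.eq] at this
  rw [this] at h01
  simp at h01

theorem counit_self (hu : IsMagicRep u) (i : V) : (u i i).1 0 = 1 := by
  have h := congrArg (character 0) (hu.magic.row i)
  rw [map_sum, map_one, Finset.sum_eq_single i] at h
  · exact h
  · exact fun k _ hk => hu.counit_eq_zero hk.symm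
  · simp

/-- Multiply `∑ₖ S(u_ik) u_km = δ_im` by `u_jm` on the right and sum over `m`: column orthogonality
leaves `k = j`, and row `j` sums to `1`. -/
theorem antipode (hu : IsMagicRep u) (i j : V) : antipodeMap (u i j) = u j i := by
  classical
  have h₁ : ∀ m, ∑ k, antipodeMap (u i k) * u k m = if i = m then 1 else 0 := fun m => by
    have := HopfAlgebra.mul_antipode_rTensor_comul_apply (R := ℂ) (u i m)
    change LinearMap.mul' ℂ KP (antipodeMap.rTensor KP (comulMap (u i m))) =
      algebraMap ℂ KP ((u i m).1 0) at this
    rw [hu.comul] at this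
    simp only [map_sum, LinearMap.rTensor_tmul, LinearMap.mul'_apply] at this
    rw [this]
    split_ifs with h
    · rw [← h, hu.counit_self, map_one]
    · rw [hu.counit_eq_zero h, map_zero]
  have h₂ : ∑ m, (∑ k, antipodeMap (u i k) * u k m) * u j m = u j i := by
    simp [h₁]
  rw [← h₂]
  simp only [Finset.sum_mul, mul_assoc]
  rw [Finset.sum_comm, Finset.sum_eq_single j]
  · simp only [(hu.magic.proj _ _).isIdempotentElem.eq]
    rw [← Finset.mul_sum, hu.magic.row, mul_one]
  · intro k _ hk
    exact Finset.sum_eq_zero fun m _ => by rw [hu.col_orthogonal m hk, mul_zero]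
  · simp

theorem haar_swap (hu : IsMagicRep u) (i j : V) : haar (u i j) = haar (u j i) := by
  rw [← hu.antipode i j, haar_antipodeMap]

/-- Invariance reads `∑ₖ h(u_kj) u_ik = h(u_ij) 1`; multiplication by `u_ik` isolates one
coefficient. -/
theorem haar_eq_of_ne_zero (hu : IsMagicRep u) {i k : V} (h : u i k ≠ 0) (j : V) :
    haar (u i j) = haar (u k j) := by
  have h₁ := haar_invariant (u i j)
  rw [hu.comul] at h₁
  simp only [map_sum, LinearMap.lTensor_tmul, TensorProduct.rid_tmul] at h₁
  have h₂ := congrArg (u i k * ·) h₁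
  simp only [Finset.mul_sum, mul_smul_comm, mul_one] at h₂
  rw [Finset.sum_eq_single k, (hu.magic.proj _ _).isIdempotentElem.eq] at h₂
  · exact (smul_left_injective ℂ h h₂).symm
  · intro l _ hl
    rw [hu.row_orthogonal i hl.symm, smul_zero]
  · simp

theorem self_ne_zero (hu : IsMagicRep u) (i : V) : u i i ≠ 0 := fun h => by
  have := hu.counit_self i
  simp [h] at this

theorem haar_ne_zero (hu : IsMagicRep u) {i j : V} : haar (u i j) ≠ 0 ↔ u i j ≠ 0 :=
  (eq_zero_iff_haar (hu.magic.proj i j)).not.symm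

/-- The orbits of a magic representation. -/
def orbitSetoid (hu : IsMagicRep u) : Setoid V where
  r i j := u i j ≠ 0
  iseqv :=
    { refl := hu.self_ne_zero
      symm := fun {i j} h => by rwa [← hu.haar_ne_zero, hu.haar_swap, hu.haar_ne_zero]
      trans := fun {i j k} hij hjk => by
        rwa [← hu.haar_ne_zero, hu.haar_eq_of_ne_zero hij, hu.haar_ne_zero] }

/-- Outside the orbit the entries vanish along its rows, hence by the antipode along its columns, so
no sum loses a term. -/
theorem submatrix_orbit (hu : IsMagicRep u) {O : Type*} [Fintype O] (g : O → V) (hg : Function.Injective g)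
    (hO : ∀ a i, u (g a) i ≠ 0 ↔ i ∈ Set.range g) : IsMagicRep (u.submatrix g g) := by
  classical
  have hs {M : Type _} [AddCommMonoid M] (F : V → M) (hF : ∀ i ∉ Set.range g, F i = 0) :
      ∑ a, F (g a) = ∑ i, F i := by
    rw [← Finset.sum_image (s := Finset.univ) (g := g) (f := F) hg.injOn]
    refine Finset.sum_subset (Finset.subset_univ _) fun i _ hi => hF i ?_
    simpa using hi
  have hO' : ∀ a, ∀ i ∉ Set.range g, u (g a) i = 0 := fun a i hi =>
    not_not.mp (mt (hO a i).mp hi)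
  have hO'' : ∀ a, ∀ i ∉ Set.range g, u i (g a) = 0 := fun a i hi => by
    rw [← hu.antipode, hO' a i hi, map_zero]
  refine ⟨⟨fun a b => hu.magic.proj _ _, fun a => ?_, fun b => ?_⟩, fun a b => ?_⟩
  · exact (hs (u (g a)) (hO' a)).trans (hu.magic.row _)
  · exact (hs (fun i => u i (g b)) (hO'' b)).trans (hu.magic.col _)
  · refine (hu.comul _ _).trans (hs (fun i => u (g a) i ⊗ₜ[ℂ] u i (g b)) fun i hi => ?_).symm
    rw [hO' a i hi, TensorProduct.zero_tmul]

theorem card_mul_haar (hu : IsMagicRep u) (h : ∀ i j, u i j ≠ 0) (i j : V) :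
    Fintype.card V * haar (u i j) = 1 := by
  have hc : ∀ k, haar (u i k) = haar (u i j) := fun k => by
    rw [hu.haar_swap i k, hu.haar_eq_of_ne_zero (h k j), hu.haar_swap j i]
  have h₁ := congrArg haar (hu.magic.row i)
  rw [map_sum, haar_one] at h₁
  simpa [hc] using h₁

end IsMagicRep

/-! ### Coordinates -/

/-- The matrix coefficients of the summand `M₂(ℂ)`. -/
def matCoord (k l : Fin 2) : KP →ₗ[ℂ] ℂ where
  toFun a := a.2 k l
  map_add' _ _ := rfl
  map_smul' _ _ := rfl

theorem matCoord_apply (k l : Fin 2) (a : KP) : matCoord k l a = a.2 k l := rfl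

theorem matCoord_f (k l : Fin 2) (i : Fin 4) : matCoord k l (f i) = 0 := rfl

theorem matCoord_E (k l m n : Fin 2) :
    matCoord k l (E m n) = if m = k ∧ n = l then 1 else 0 := by
  simp [matCoord_apply, Matrix.single_apply]

/-- The product of two linear functionals, as a functional on `C(G₀) ⊗ C(G₀)`. -/
def pairing (φ ψ : KP →ₗ[ℂ] ℂ) : KP ⊗[ℂ] KP →ₗ[ℂ] ℂ :=
  LinearMap.mul' ℂ ℂ ∘ₗ TensorProduct.map φ ψ

@[simp] theorem pairing_tmul (φ ψ : KP →ₗ[ℂ] ℂ) (a b : KP) :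
    pairing φ ψ (a ⊗ₜ b) = φ a * ψ b := by
  simp [pairing]

open Complex (I)

/-- This lemma and the next three extract coefficients of `E k l ⊗ E m n` in `Δ(a)`, which depend
only on the commutative part of `a`. Applied to a diagonal entry, they become quadratic equations
for the `M₂(ℂ)` parts of its row. -/
theorem pairing_comulMap_diag (a : KP) :
    pairing (matCoord 0 0) (matCoord 0 0) (comulMap a) = (a.1 0 + a.1 3) / 2 := by
  conv_lhs => rw [eq_sum a]
  simp [Fin.sum_univ_four, comulF, comulE, matCoord_f, matCoord_E]
  ring

theorem pairing_comulMap_offDiag (a : KP) :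
    pairing (matCoord 0 1) (matCoord 0 1) (comulMap a) = (a.1 0 - a.1 3) / 2 := by
  conv_lhs => rw [eq_sum a]
  simp [Fin.sum_univ_four, comulF, comulE, matCoord_f, matCoord_E]
  ring

theorem pairing_comulMap_upper_lower (a : KP) :
    pairing (matCoord 0 1) (matCoord 1 0) (comulMap a) = -(I / 2) * (a.1 1 - a.1 2) := by
  conv_lhs => rw [eq_sum a]
  simp [Fin.sum_univ_four, comulF, comulE, matCoord_f, matCoord_E]
  ring

theorem pairing_comulMap_lower_upper (a : KP) :
    pairing (matCoord 1 0) (matCoord 0 1) (comulMap a) = (I / 2) * (a.1 1 - a.1 2) := by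
  conv_lhs => rw [eq_sum a]
  simp [Fin.sum_univ_four, comulF, comulE, matCoord_f, matCoord_E]
  ring

theorem IsMagicRep.pairing_comulMap {V : Type*} [Fintype V] {u : Matrix V V KP}
    (hu : IsMagicRep u) (φ ψ : KP →ₗ[ℂ] ℂ) (i j : V) :
    pairing φ ψ (comulMap (u i j)) = ∑ k, φ (u i k) * ψ (u k j) := by
  simp [hu.comul]

theorem IsMagicRep.snd_swap {V : Type*} [Fintype V] {u : Matrix V V KP}
    (hu : IsMagicRep u) (i j : V) (k l : Fin 2) : (u j i).2 k l = (u i j).2 l k := by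
  rw [← hu.antipode i j]
  rfl

/-! ### Projections in `C(G₀)` -/

theorem ofMat_fst (m : Matrix (Fin 2) (Fin 2) ℂ) : (ofMat m).1 = 0 := rfl

theorem ofMat_snd (m : Matrix (Fin 2) (Fin 2) ℂ) : (ofMat m).2 = m := rfl

theorem ofMat_injective : Function.Injective ofMat := fun _ _ h => congrArg Prod.snd h

theorem isStarProjection_fst {a : KP} (ha : IsStarProjection a) (i : Fin 4) :
    a.1 i = 0 ∨ a.1 i = 1 := by
  have : a.1 i * a.1 i = a.1 i := congrFun (congrArg Prod.fst ha.isIdempotentElem.eq) i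
  exact IsIdempotentElem.iff_eq_zero_or_one.mp this

/-- The three cases are rank `0`, `2` and `1`, the last recorded only by its trace: an idempotent
2×2 matrix of trace different from `1` is scalar. -/
theorem isStarProjection_snd {a : KP} (ha : IsStarProjection a) :
    a.2 = 0 ∨ a.2 = 1 ∨ a.2 1 1 = 1 - a.2 0 0 := by
  have h : a.2 * a.2 = a.2 := congrArg Prod.snd ha.isIdempotentElem.eq
  have h00 := congrFun (congrFun h 0) 0
  have h01 := congrFun (congrFun h 0) 1
  have h10 := congrFun (congrFun h 1) 0
  have h11 := congrFun (congrFun h 1) 1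
  simp only [Matrix.mul_apply, Fin.sum_univ_two] at h00 h01 h10 h11
  by_cases ht : a.2 1 1 = 1 - a.2 0 0
  · exact .inr (.inr ht)
  have ht' : a.2 0 0 + a.2 1 1 - 1 ≠ 0 := fun h => ht (by linear_combination h)
  have e01 : a.2 0 1 = 0 :=
    (mul_eq_zero.mp (show (a.2 0 0 + a.2 1 1 - 1) * a.2 0 1 = 0 by
        linear_combination h01)).resolve_left ht'
  have e10 : a.2 1 0 = 0 :=
    (mul_eq_zero.mp (show (a.2 0 0 + a.2 1 1 - 1) * a.2 1 0 = 0 by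
        linear_combination h10)).resolve_left ht'
  rw [e01, zero_mul, add_zero] at h00
  rw [e10, zero_mul, zero_add] at h11
  have heq : a.2 1 1 = a.2 0 0 := by
    refine sub_eq_zero.mp ((mul_eq_zero.mp
      (show (a.2 0 0 + a.2 1 1 - 1) * (a.2 1 1 - a.2 0 0) = 0 by
        linear_combination h11 - h00)).resolve_left ht')
  rcases IsIdempotentElem.iff_eq_zero_or_one.mp h00 with h0 | h0
  · left
    ext i j
    fin_cases i <;> fin_cases j <;> simp [e01, e10, heq, h0]
  · right; left
    ext i j
    fin_cases i <;> fin_cases j <;> simp [e01, e10, heq, h0]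

theorem haar_eq (a : KP) :
    8 * haar a = a.1 0 + a.1 1 + a.1 2 + a.1 3 + 2 * (a.2 0 0 + a.2 1 1) := by
  rw [haar_apply, Fin.sum_univ_four, Matrix.trace_fin_two]
  ring

/-- For a nonzero projection below the counit, `8 h(a)` is a positive integer. -/
theorem haar_eq_natCast {a : KP} (ha : IsStarProjection a) (h0 : a.1 0 = 1) :
    ∃ m : ℕ, 0 < m ∧ m ≤ 8 ∧ 8 * haar a = m := by
  rw [haar_eq, h0]
  have h₂ : ∃ m : ℕ, m ≤ 2 ∧ a.2 0 0 + a.2 1 1 = m := by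
    rcases isStarProjection_snd ha with h | h | h
    · exact ⟨0, by simp [h]⟩
    · exact ⟨2, by simp [h]; norm_num⟩
    · exact ⟨1, by simp [h]⟩
  have h₁ : ∀ i, ∃ m : ℕ, m ≤ 1 ∧ a.1 i = m := fun i => by
    rcases isStarProjection_fst ha i with h | h
    · exact ⟨0, by simp [h]⟩
    · exact ⟨1, by simp [h]⟩
  obtain ⟨m₁, _, e₁⟩ := h₁ 1
  obtain ⟨m₂, _, e₂⟩ := h₁ 2
  obtain ⟨m₃, _, e₃⟩ := h₁ 3
  obtain ⟨m, _, e⟩ := h₂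
  refine ⟨1 + m₁ + m₂ + m₃ + 2 * m, by omega, by omega, ?_⟩
  rw [e₁, e₂, e₃, e]
  push_cast
  ring

/-- Projections of Haar measure `1/4`. -/
theorem haar_eq_quarter {a : KP} (ha : IsStarProjection a) (h : 8 * haar a = 2) :
    (a.1 = 0 ∧ a.2 1 1 = 1 - a.2 0 0) ∨ (a.2 = 0 ∧ a.1 0 + a.1 1 + a.1 2 + a.1 3 = 2) := by
  rw [haar_eq] at h
  rcases isStarProjection_snd ha with h₂ | h₂ | h₂
  · exact .inr ⟨h₂, by simpa [h₂] using h⟩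
  · exfalso
    rw [h₂] at h
    rcases isStarProjection_fst ha 0 with h0 | h0 <;>
    rcases isStarProjection_fst ha 1 with h1 | h1 <;>
    rcases isStarProjection_fst ha 2 with h2 | h2 <;>
    rcases isStarProjection_fst ha 3 with h3 | h3 <;>
      rw [h0, h1, h2, h3] at h <;> norm_num at h
  · refine .inl ⟨?_, h₂⟩
    rw [h₂] at h
    rcases isStarProjection_fst ha 0 with h0 | h0 <;>
    rcases isStarProjection_fst ha 1 with h1 | h1 <;>
    rcases isStarProjection_fst ha 2 with h2 | h2 <;>
    rcases isStarProjection_fst ha 3 with h3 | h3 <;>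
      rw [h0, h1, h2, h3] at h <;> ring_nf at h <;> norm_num at h
    ext i
    fin_cases i <;> assumption

/-! ### The rank one projections -/

theorem p_upper_sq : p 0 1 * p 0 1 = -(I / 4) := by
  have h : Complex.exp (-(Real.pi / 4 * I)) * Complex.exp (-(Real.pi / 4 * I)) = -I := by
    rw [← Complex.exp_add, show -(Real.pi / 4 * I) + -(Real.pi / 4 * I) = -((Real.pi / 2 : ℂ) * I)
      by ring, Complex.exp_neg, Complex.exp_pi_div_two_mul_I, Complex.inv_I]
  simp only [p, Matrix.of_apply, Matrix.cons_val]
  linear_combination h / 4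

theorem p_lower_sq : p 1 0 * p 1 0 = I / 4 := by
  have h : Complex.exp (Real.pi / 4 * I) * Complex.exp (Real.pi / 4 * I) = I := by
    rw [← Complex.exp_add, show Real.pi / 4 * I + Real.pi / 4 * I = (Real.pi / 2 : ℂ) * I
      by ring, Complex.exp_pi_div_two_mul_I]
  simp only [p, Matrix.of_apply, Matrix.cons_val]
  linear_combination h / 4

theorem p_upper_mul_lower : p 0 1 * p 1 0 = 1 / 4 := by
  have h : Complex.exp (-(Real.pi / 4 * I)) * Complex.exp (Real.pi / 4 * I) = 1 := by
    rw [← Complex.exp_add, neg_add_cancel, Complex.exp_zero]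
  simp only [p, Matrix.of_apply, Matrix.cons_val]
  linear_combination h / 4

theorem p_upper_left : p 0 0 = 1 / 2 := rfl

theorem p_lower_right : p 1 1 = 1 / 2 := rfl

/-- The rank one projection in the row whose diagonal entry is `f 0 + f s`. -/
def rankOne : Fin 4 → Matrix (Fin 2) (Fin 2) ℂ :=
  ![0, p, p.transpose, Matrix.single 0 0 1]

theorem rankOne_one : rankOne 1 = p := rfl

theorem rankOne_two : rankOne 2 = p.transpose := rfl

theorem rankOne_three : rankOne 3 = Matrix.single 0 0 1 := rfl

theorem matrix_two_ext {A B : Matrix (Fin 2) (Fin 2) ℂ} (h₀₀ : A 0 0 = B 0 0)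
    (h₀₁ : A 0 1 = B 0 1) (h₁₀ : A 1 0 = B 1 0) (h₁₁ : A 1 1 = B 1 1) : A = B := by
  ext i j
  fin_cases i <;> fin_cases j <;> assumption

theorem f_fst_apply (i j : Fin 4) : (f i).1 j = if j = i then 1 else 0 :=
  Pi.single_apply i 1 j

theorem eq_half_of_sq_add_sq {z : ℂ} (hz : z * z + (1 - z) * (1 - z) = 1 / 2) : z = 1 / 2 := by
  have : (z - 1 / 2) * (z - 1 / 2) = 0 := by linear_combination hz / 2
  exact sub_eq_zero.mp (mul_self_eq_zero.mp this)

/-- The diagonal is forced to be `1/2`, so only the sign of the off-diagonal part is free, and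
changing that sign is passing to the complement. -/
theorem eq_or_eq_one_sub {P Q : Matrix (Fin 2) (Fin 2) ℂ} (hP : P 1 1 = 1 - P 0 0)
    (h₁ : P 0 0 * P 0 0 + (1 - P 0 0) * (1 - P 0 0) = 1 / 2)
    (hQ₀ : Q 0 0 = 1 / 2) (hQ₁ : Q 1 1 = 1 / 2) (hQ : Q 0 1 ≠ 0)
    (h₂ : P 0 1 * P 1 0 = Q 0 1 * Q 1 0) (h₃ : P 0 1 * P 0 1 = Q 0 1 * Q 0 1) :
    P = Q ∨ P = 1 - Q := by
  have e := eq_half_of_sq_add_sq h₁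
  rcases mul_self_eq_mul_self_iff.mp h₃ with h | h
  · refine .inl (matrix_two_ext (by rw [e, hQ₀]) h ?_ (by rw [hP, e, hQ₁]; norm_num))
    exact mul_left_cancel₀ hQ (by rw [← h₂, h])
  · refine .inr (matrix_two_ext ?_ ?_ ?_ ?_)
    · simp only [Matrix.sub_apply, Matrix.one_apply_eq, e, hQ₀]; norm_num
    · simp [h]
    · have : P 1 0 = -Q 1 0 := mul_left_cancel₀ hQ (by rw [h] at h₂; linear_combination -h₂)
      simp [this]
    · simp only [Matrix.sub_apply, Matrix.one_apply_eq, hP, e, hQ₁]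

theorem p_upper_ne_zero : p 0 1 ≠ 0 := fun h => by
  have := p_upper_mul_lower
  simp [h] at this

theorem p_lower_ne_zero : p 1 0 ≠ 0 := fun h => by
  have := p_upper_mul_lower
  simp [h] at this

/-- A solution of the quadratic equations satisfied by the entries of `rankOne s` is `rankOne s`
or its complement. -/
theorem eq_rankOne {s : Fin 4} (hs : s ≠ 0) {P : Matrix (Fin 2) (Fin 2) ℂ}
    (htr : P 1 1 = 1 - P 0 0)
    (h₁ : P 0 0 * P 0 0 + (1 - P 0 0) * (1 - P 0 0) = ((f 0 + f s).1 0 + (f 0 + f s).1 3) / 2)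
    (h₂ : 2 * (P 0 1 * P 1 0) = ((f 0 + f s).1 0 - (f 0 + f s).1 3) / 2)
    (h₃ : 2 * (P 0 1 * P 0 1) = -(I / 2) * ((f 0 + f s).1 1 - (f 0 + f s).1 2))
    (h₄ : 2 * (P 1 0 * P 1 0) = (I / 2) * ((f 0 + f s).1 1 - (f 0 + f s).1 2)) :
    P = rankOne s ∨ P = 1 - rankOne s := by
  obtain rfl | rfl | rfl : s = 1 ∨ s = 2 ∨ s = 3 := by clear h₁ h₂ h₃ h₄; revert s; decide
  · simp at h₁ h₂ h₃
    exact eq_or_eq_one_sub htr (by rw [h₁, one_div]) p_upper_left p_lower_right p_upper_ne_zero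
      (by rw [rankOne_one]; linear_combination h₂ / 2 - p_upper_mul_lower)
      (by rw [rankOne_one]; linear_combination h₃ / 2 - p_upper_sq)
  · simp at h₁ h₂ h₃
    exact eq_or_eq_one_sub htr (by rw [h₁, one_div]) p_upper_left p_lower_right p_lower_ne_zero
      (by rw [rankOne_two, Matrix.transpose_apply, Matrix.transpose_apply]
          linear_combination h₂ / 2 - p_upper_mul_lower)
      (by rw [rankOne_two, Matrix.transpose_apply]; linear_combination h₃ / 2 - p_lower_sq)
  -- For `s = 3` the equations degenerate: the off-diagonal entries vanish and `P 0 0` is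
  -- idempotent.
  · simp at h₁ h₂ h₃ h₄
    have : P 0 0 * P 0 0 = P 0 0 := by linear_combination h₁ / 2
    rw [rankOne_three]
    rcases IsIdempotentElem.iff_eq_zero_or_one.mp this with h | h
    · right
      refine matrix_two_ext ?_ ?_ ?_ ?_ <;> simp [h, h₃, h₄, htr]
    · left
      refine matrix_two_ext ?_ ?_ ?_ ?_ <;> simp [h, h₃, h₄, htr]

/-! ### Transitive magic representations -/

/-- The complement of `f 0 + f s` in the commutative summand. -/
def rest (s : Fin 4) : KP := 1 - ofMat 1 - (f 0 + f s)

theorem KP.fst_sub (a b : KP) : (a - b).1 = a.1 - b.1 := rfl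

theorem KP.snd_sub (a b : KP) : (a - b).2 = a.2 - b.2 := rfl

theorem rest_fst_apply (s t : Fin 4) :
    (rest s).1 t = 1 - ((if t = 0 then 1 else 0) + if t = s then 1 else 0) := by
  change 1 - 0 - ((f 0).1 t + (f s).1 t) = _
  rw [f_fst_apply, f_fst_apply, sub_zero]

theorem rest_snd (s : Fin 4) : (rest s).2 = 0 := by
  change (1 : Matrix (Fin 2) (Fin 2) ℂ) - 1 - (0 + 0) = 0
  simp

theorem f_add_f_fst_apply (s t : Fin 4) :
    (f 0 + f s).1 t = (if t = 0 then 1 else 0) + if t = s then 1 else 0 := by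
  rw [KP.fst_add, Pi.add_apply, f_fst_apply, f_fst_apply]

theorem f_add_f_snd (s t : Fin 4) : (f s + f t).2 = 0 := add_zero 0

theorem rest_fst_ne_zero (s : Fin 4) : (rest s).1 ≠ 0 := by
  intro h
  have h₁ := congrFun h 1
  have h₂ := congrFun h 2
  rw [rest_fst_apply] at h₁ h₂
  by_cases hs : s = 1
  · simp [hs] at h₂
  · simp [Ne.symm hs] at h₁

theorem rest_injective {s t : Fin 4} (hs : s ≠ 0) (h : rest s = rest t) : s = t := by
  have h₁ := congrFun (congrArg Prod.fst h) s
  change (rest s).1 s = (rest t).1 s at h₁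
  rw [rest_fst_apply, rest_fst_apply] at h₁
  by_contra hst
  simp [hs, hst] at h₁

theorem rest_one : rest 1 = f 2 + f 3 := by
  refine KP.ext (fun i => ?_) fun k l => ?_
  · rw [rest_fst_apply, KP.fst_add, Pi.add_apply, f_fst_apply, f_fst_apply]
    revert i
    simp [Fin.forall_fin_succ]
  · rw [rest_snd, f_add_f_snd]

theorem rest_two : rest 2 = f 1 + f 3 := by
  refine KP.ext (fun i => ?_) fun k l => ?_
  · rw [rest_fst_apply, KP.fst_add, Pi.add_apply, f_fst_apply, f_fst_apply]
    revert i
    simp [Fin.forall_fin_succ]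
  · rw [rest_snd, f_add_f_snd]

theorem rest_three : rest 3 = f 1 + f 2 := by
  refine KP.ext (fun i => ?_) fun k l => ?_
  · rw [rest_fst_apply, KP.fst_add, Pi.add_apply, f_fst_apply, f_fst_apply]
    revert i
    simp [Fin.forall_fin_succ]
  · rw [rest_snd, f_add_f_snd]

theorem antipodeMap_rest (s : Fin 4) : antipodeMap (rest s) = rest s := by
  refine KP.ext (fun _ => rfl) fun k l => ?_
  change (rest s).2 l k = (rest s).2 k l
  rw [rest_snd]
  rfl

theorem antipodeMap_ofMat (m : Matrix (Fin 2) (Fin 2) ℂ) :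
    antipodeMap (ofMat m) = ofMat m.transpose := rfl

theorem exists_fst_eq {a : KP} (ha : IsStarProjection a) (h0 : a.1 0 = 1)
    (hsum : a.1 0 + a.1 1 + a.1 2 + a.1 3 = 2) : ∃ s ≠ 0, a.1 = (f 0 + f s).1 := by
  have key : ∀ s ≠ 0, (∀ t, a.1 t = (if t = 0 then 1 else 0) + if t = s then 1 else 0) →
      ∃ s ≠ 0, a.1 = (f 0 + f s).1 := fun s hs h =>
    ⟨s, hs, funext fun t => by rw [f_add_f_fst_apply, h]⟩
  rcases isStarProjection_fst ha 1 with h1 | h1 <;>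
  rcases isStarProjection_fst ha 2 with h2 | h2 <;>
  rcases isStarProjection_fst ha 3 with h3 | h3 <;> rw [h0, h1, h2, h3] at hsum <;>
    norm_num at hsum
  · exact key 3 (by decide) (by simp [Fin.forall_fin_succ, h0, h1, h2, h3])
  · exact key 2 (by decide) (by simp [Fin.forall_fin_succ, h0, h1, h2, h3])
  · exact key 1 (by decide) (by simp [Fin.forall_fin_succ, h0, h1, h2, h3])

theorem eq_rest {a : KP} (ha : IsStarProjection a) {s : Fin 4} (hs : s ≠ 0) (h0 : a.1 0 = 0)
    (h : a.1 s = 0) (ha2 : a.2 = 0) (hsum : a.1 0 + a.1 1 + a.1 2 + a.1 3 = 2) : a = rest s := by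
  refine KP.ext (fun t => ?_) fun k l => by rw [ha2, rest_snd]
  rw [rest_fst_apply]
  revert t
  rcases isStarProjection_fst ha 1 with h1 | h1 <;>
  rcases isStarProjection_fst ha 2 with h2 | h2 <;>
  rcases isStarProjection_fst ha 3 with h3 | h3 <;> rw [h0, h1, h2, h3] at hsum <;>
    norm_num at hsum <;>
  obtain rfl | rfl | rfl : s = 1 ∨ s = 2 ∨ s = 3 := by clear h; revert s; decide
  all_goals first | (simp [h1, h2, h3] at h; done) | simp [Fin.forall_fin_succ, h0, h1, h2, h3]

theorem exists_equiv_fin_four {V : Type*} [Fintype V] (hV : Fintype.card V = 4) {i j : V}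
    (hij : i ≠ j) : ∃ e : Fin 4 ≃ V, e 0 = i ∧ e 1 = j := by
  classical
  let e₀ := (Fintype.equivFinOfCardEq hV).symm
  let e₁ := e₀.trans (Equiv.swap (e₀ 0) i)
  have h₁ : e₁ 0 = i := Equiv.swap_apply_left _ _
  refine ⟨e₁.trans (Equiv.swap (e₁ 1) j), ?_, Equiv.swap_apply_left _ _⟩
  change Equiv.swap (e₁ 1) j (e₁ 0) = i
  rw [h₁, Equiv.swap_apply_of_ne_of_ne _ hij]
  rw [← h₁]
  exact e₁.injective.ne (by decide)

namespace IsMagicRep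

variable {V : Type*} [Fintype V] {u : Matrix V V KP}

theorem fst_mul_fst (hu : IsMagicRep u) {i j k : V} (h : j ≠ k) (t : Fin 4) :
    (u i j).1 t * (u i k).1 t = 0 :=
  congrFun (congrArg Prod.fst (hu.row_orthogonal i h)) t

theorem exists_fst_ne_zero (hu : IsMagicRep u) (i : V) (t : Fin 4) : ∃ j, (u i j).1 t ≠ 0 := by
  by_contra! h
  have h₁ := congrArg (character t) (hu.magic.row i)
  rw [map_sum, map_one] at h₁
  exact zero_ne_one ((Finset.sum_eq_zero fun j _ => h j).symm.trans h₁)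

/-- The counit puts `u i i` in the commutative summand, where it has the form `f 0 + f s`. One
further entry must absorb the other two `f`'s, and the remaining two are complementary rank one
projections in `M₂(ℂ)`. -/
theorem exists_row_of_card_eq_four (hu : IsMagicRep u) (h8 : ∀ i j,
    8 * haar (u i j) = 2) (hV : Fintype.card V = 4)
    (i : V) : ∃ s ≠ 0, ∃ e : Fin 4 ≃ V, e 0 = i ∧ u i i = f 0 + f s ∧ u i (e 1) = rest s ∧
      u i (e 2) = ofMat (rankOne s) ∧ u i (e 3) = ofMat (1 - rankOne s) := by
  obtain ⟨hi2, hisum⟩ := (haar_eq_quarter (hu.magic.proj i i) (h8 i i)).resolve_left fun h => by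
    have := hu.counit_self i
    rw [h.1] at this
    exact zero_ne_one this
  obtain ⟨s, hs, hi1⟩ := exists_fst_eq (hu.magic.proj i i) (hu.counit_self i) hisum
  have hii : u i i = f 0 + f s := Prod.ext hi1 (by rw [hi2]; exact (f_add_f_snd 0 s).symm)
  -- Some entry of the row is nonzero at a summand `b` not covered by `u i i`; it is commutative of
  -- Haar measure `1/4`, so it exhausts the rest.
  obtain ⟨b, hb0, hbs⟩ : ∃ b : Fin 4, b ≠ 0 ∧ b ≠ s := by clear hii hi1 hs; revert s; decide
  obtain ⟨j, hj⟩ := hu.exists_fst_ne_zero i b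
  have hij : i ≠ j := by
    rintro rfl
    rw [hi1, f_add_f_fst_apply] at hj
    simp [hb0, hbs] at hj
  obtain ⟨hj2, hjsum⟩ := (haar_eq_quarter (hu.magic.proj i j) (h8 i j)).resolve_left fun h => by
    rw [h.1] at hj
    exact hj rfl
  have hjr : u i j = rest s := by
    refine eq_rest (hu.magic.proj i j) hs (hu.counit_eq_zero hij) ?_ hj2 hjsum
    have := hu.fst_mul_fst (i := i) hij s
    rw [hi1, f_add_f_fst_apply] at this
    simpa [hs] using this
  obtain ⟨e, he0, he1⟩ := exists_equiv_fin_four hV hij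
  have hsum {M : Type} [AddCommMonoid M] (F : V → M) :
      ∑ x, F x = F i + F j + F (e 2) + F (e 3) := by
    rw [← Equiv.sum_comp e, Fin.sum_univ_four, he0, he1]
  have hk1 : (u i (e 2)).1 = 0 := by
    have h₁ := hu.row_orthogonal i (show i ≠ e 2 by rw [← he0]; exact e.injective.ne (by decide))
    have h₂ := hu.row_orthogonal i (show j ≠ e 2 by rw [← he1]; exact e.injective.ne (by decide))
    rw [hii] at h₁
    rw [hjr] at h₂
    have h₃ : (1 - ofMat 1) * u i (e 2) = 0 := by
      rw [show (1 - ofMat 1 : KP) = f 0 + f s + rest s by rw [rest]; abel, add_mul, h₁, h₂,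
          add_zero]
    have h₄ : ((1 : Fin 4 → ℂ) - 0) * (u i (e 2)).1 = 0 := congrArg Prod.fst h₃
    rwa [sub_zero, one_mul] at h₄
  have hk : u i (e 2) = ofMat (u i (e 2)).2 := Prod.ext hk1 rfl
  have htr : (u i (e 2)).2 1 1 = 1 - (u i (e 2)).2 0 0 :=
    ((haar_eq_quarter (hu.magic.proj i (e 2)) (h8 i (e 2))).resolve_right fun h => by
      have := h.2
      rw [hk1] at this
      norm_num at this).2
  have hl : u i (e 3) = ofMat (1 - (u i (e 2)).2) := by
    have h₁ := hu.magic.row i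
    rw [hsum, hii, hjr] at h₁
    have h₂ : ofMat (1 - (u i (e 2)).2) = ofMat 1 - u i (e 2) := by
      conv_rhs => rw [hk]
      exact Prod.ext (sub_zero 0).symm rfl
    rw [h₂, ← sub_eq_zero, ← sub_eq_zero.mpr h₁, rest]
    abel
  generalize (u i (e 2)).2 = P at hk htr hl
  -- By the antipode the column through `i` is the transpose of the row, so the coefficients of `Δ(u
  -- i i)` are quadratic in `P` alone.
  have hP : P = rankOne s ∨ P = 1 - rankOne s := by
    have pair (k l m n : Fin 2) : pairing (matCoord k l) (matCoord m n) (comulMap (u i i)) =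
        P k l * P n m + (1 - P) k l * (1 - P) n m := by
      rw [hu.pairing_comulMap, hsum]
      simp only [matCoord_apply, hu.snd_swap i, hii, hjr, hk, hl, ofMat_snd, rest_snd,
        f_add_f_snd, Matrix.zero_apply]
      ring
    have h₁ := pair 0 0 0 0
    have h₂ := pair 0 1 0 1
    have h₃ := pair 0 1 1 0
    have h₄ := pair 1 0 0 1
    rw [pairing_comulMap_diag, hii] at h₁
    rw [pairing_comulMap_offDiag, hii] at h₂
    rw [pairing_comulMap_upper_lower, hii] at h₃
    rw [pairing_comulMap_lower_upper, hii] at h₄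
    simp only [Matrix.sub_apply, Matrix.one_apply_eq, ne_eq, zero_ne_one, one_ne_zero,
      not_false_eq_true, Matrix.one_apply_ne, zero_sub] at h₁ h₂ h₃ h₄
    exact eq_rankOne hs htr h₁.symm (by rw [h₂]; ring) (by rw [h₃]; ring) (by rw [h₄]; ring)
  rcases hP with rfl | rfl
  · exact ⟨s, hs, e, he0, hii, by rw [he1, hjr], hk, hl⟩
  -- When `P` is the complement, exchanging the last two labels restores the normal form.
  · refine ⟨s, hs, (Equiv.swap 2 3).trans e, he0, hii, ?_, ?_, hk⟩
    · exact (congrArg (u i) he1).trans hjr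
    · rw [sub_sub_cancel] at hl
      exact hl

end IsMagicRep

/-- The transitive magic representations on four points. -/
def transitiveFour (s t : Fin 4) : Matrix (Fin 4) (Fin 4) KP :=
  !![f 0 + f s, rest s, ofMat (rankOne s), ofMat (1 - rankOne s);
    rest s, f 0 + f s, ofMat (1 - rankOne s), ofMat (rankOne s);
    ofMat (rankOne s).transpose, ofMat (1 - rankOne s).transpose, f 0 + f t, rest t;
    ofMat (1 - rankOne s).transpose, ofMat (rankOne s).transpose, rest t, f 0 + f t]

/-- The square of an off-diagonal entry does not see complements, and its values `-i/4`, `i/4`, `0`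
separate the three types; transposition exchanges the first two. -/
theorem transpose_rankOne_eq {s t : Fin 4} (hs : s ≠ 0) (ht : t ≠ 0)
    (h : (rankOne s).transpose = rankOne t ∨ (rankOne s).transpose = 1 - rankOne t) :
    t = Equiv.swap 1 2 s := by
  have h' : rankOne s 1 0 * rankOne s 1 0 = rankOne t 0 1 * rankOne t 0 1 := by
    rcases h with h | h
    · have := congrFun (congrFun h 0) 1
      rw [Matrix.transpose_apply] at this
      rw [this]
    · have := congrFun (congrFun h 0) 1
      rw [Matrix.transpose_apply] at this
      rw [this]
      simp
  clear h
  obtain rfl | rfl | rfl : s = 1 ∨ s = 2 ∨ s = 3 := by clear h'; revert s; decide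
  all_goals
    obtain rfl | rfl | rfl : t = 1 ∨ t = 2 ∨ t = 3 := by clear h'; revert t; decide
  all_goals first
    | decide
    | exfalso
      simp only [rankOne_one, rankOne_two, rankOne_three, Matrix.transpose_apply, p_upper_sq,
        p_lower_sq] at h'
      have := congrArg Complex.im h'
      norm_num at this

/-- One row is normalised by `exists_row_of_card_eq_four`, and the antipode gives its column. The
same lemma applied to rows `e 1` and `e 2` fills in the rest, once its labellings are matched with
`e`. -/
theorem IsMagicRep.exists_equiv_of_card_eq_four {V : Type*} [Fintype V] {u : Matrix V V KP}
    (hu : IsMagicRep u) (h8 : ∀ i j, 8 * haar (u i j) = 2) (hV : Fintype.card V = 4) :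
    ∃ s ≠ 0, ∃ e : Fin 4 ≃ V,
      u.submatrix e e = transitiveFour s (Equiv.swap 1 2 s) := by
  have hne : ∀ i j, u i j ≠ 0 := fun i j h => by
    have := h8 i j
    rw [h, map_zero] at this
    norm_num at this
  obtain ⟨i₀⟩ : Nonempty V := Fintype.card_pos_iff.mp (by omega)
  obtain ⟨s, hs, e, he0, hii, hij, hik, hil⟩ := hu.exists_row_of_card_eq_four h8 hV i₀
  subst he0
  have hji : u (e 1) (e 0) = rest s := by rw [← hu.antipode, hij, antipodeMap_rest]
  have hki : u (e 2) (e 0) = ofMat (rankOne s).transpose := by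
    rw [← hu.antipode, hik, antipodeMap_ofMat]
  have hli : u (e 3) (e 0) = ofMat (1 - rankOne s).transpose := by
    rw [← hu.antipode, hil, antipodeMap_ofMat]
  -- The known entry `rest s` at column `e 0` forces the same parameter `s` for this row. The order
  -- of its two rank one projections is opposite to that of row `e 0`, since equal nonzero
  -- projections in a column are not orthogonal.
  obtain ⟨hjj, hjk, hjl⟩ : u (e 1) (e 1) = f 0 + f s ∧ u (e 1) (e 2) = ofMat (1 - rankOne s) ∧
      u (e 1) (e 3) = ofMat (rankOne s) := by
    obtain ⟨s', hs', e', he0', hjj, hj1, hj2, hj3⟩ :=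
      hu.exists_row_of_card_eq_four h8 hV (e 1)
    have hinv (x : Fin 4) : ∃ y, e' y = e x := ⟨e'.symm (e x), e'.apply_symm_apply _⟩
    obtain ⟨x, hx⟩ := hinv 0
    have hx1 : x = 1 := by
      have hx0 : x ≠ 0 := by
        rintro rfl
        exact absurd (e.injective (he0'.symm.trans hx)) (by decide)
      have hx' : x ≠ 2 ∧ x ≠ 3 := by
        refine ⟨?_, ?_⟩ <;> rintro rfl <;> apply rest_fst_ne_zero s <;> rw [← hji, ← hx]
        · rw [hj2]; rfl
        · rw [hj3]; rfl
      clear hx; revert x; decide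
    subst hx1
    rw [hx, hji] at hj1
    obtain rfl := rest_injective hs hj1
    obtain ⟨y, hy⟩ := hinv 2
    have hy3 : y = 3 := by
      have hy0 : y ≠ 0 := by
        rintro rfl
        exact absurd (e.injective (he0'.symm.trans hy)) (by decide)
      have hy1 : y ≠ 1 := by
        rintro rfl
        exact absurd (e.injective (hx.symm.trans hy)) (by decide)
      have hy2 : y ≠ 2 := by
        rintro rfl
        rw [hy, ← hik] at hj2
        have := hu.col_orthogonal (e 2) (e.injective.ne (show (1 : Fin 4) ≠ 0 by decide))
        rw [hj2, (hu.magic.proj _ _).isIdempotentElem.eq] at this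
        exact hne _ _ this
      clear hy; revert y; decide
    subst hy3
    obtain ⟨z, hz⟩ := hinv 3
    have hz2 : z = 2 := by
      have hz0 : z ≠ 0 := by
        rintro rfl
        exact absurd (e.injective (he0'.symm.trans hz)) (by decide)
      have hz1 : z ≠ 1 := by
        rintro rfl
        exact absurd (e.injective (hx.symm.trans hz)) (by decide)
      have hz2 : z ≠ 3 := by
        rintro rfl
        exact absurd (e.injective (hy.symm.trans hz)) (by decide)
      clear hz; revert z; decide
    subst hz2
    exact ⟨hjj, by rw [← hy, hj3], by rw [← hz, hj2]⟩
  have hkj : u (e 2) (e 1) = ofMat (1 - rankOne s).transpose := by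
    rw [← hu.antipode, hjk, antipodeMap_ofMat]
  have hlj : u (e 3) (e 1) = ofMat (rankOne s).transpose := by
    rw [← hu.antipode, hjl, antipodeMap_ofMat]
  -- Columns `e 0` and `e 1` of this row lie in `M₂(ℂ)`, so its `rest` entry is at `e 3`. Its entry
  -- at `e 0` is the transpose of `rankOne s`, which fixes the parameter `t`.
  obtain ⟨hkk, hkl⟩ : u (e 2) (e 2) = f 0 + f (Equiv.swap 1 2 s) ∧
      u (e 2) (e 3) = rest (Equiv.swap 1 2 s) := by
    obtain ⟨t, ht, e', he0', hkk, hk1, hk2, hk3⟩ :=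
      hu.exists_row_of_card_eq_four h8 hV (e 2)
    have hne1 (x : Fin 4) (hx : (u (e 2) (e x)).1 = 0) : e' 1 ≠ e x := fun h => by
      rw [← h, hk1] at hx
      exact rest_fst_ne_zero t hx
    have h1 : e' 1 = e 3 := by
      obtain ⟨x, hx⟩ : ∃ x, e x = e' 1 := ⟨e.symm (e' 1), e.apply_symm_apply _⟩
      have hx0 : x ≠ 0 := by
        rintro rfl
        exact hne1 0 (by rw [hki]; rfl) hx.symm
      have hx1 : x ≠ 1 := by
        rintro rfl
        exact hne1 1 (by rw [hkj]; rfl) hx.symm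
      have hx2 : x ≠ 2 := by
        rintro rfl
        exact absurd (e'.injective (he0'.trans hx)) (by decide)
      obtain rfl : x = 3 := by clear hx; revert x; decide
      exact hx.symm
    have hst : t = Equiv.swap 1 2 s := by
      refine transpose_rankOne_eq hs ht ?_
      obtain ⟨x, hx⟩ : ∃ x, e' x = e 0 := ⟨e'.symm (e 0), e'.apply_symm_apply _⟩
      have hx0 : x ≠ 0 := by
        rintro rfl
        exact absurd (e.injective (he0'.symm.trans hx)) (by decide)
      have hx1 : x ≠ 1 := by
        rintro rfl
        exact absurd (e.injective (h1.symm.trans hx)) (by decide)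
      obtain rfl | rfl : x = 2 ∨ x = 3 := by clear hx; revert x; decide
      · left
        rw [hx, hki] at hk2
        exact ofMat_injective hk2
      · right
        rw [hx, hki] at hk3
        exact ofMat_injective hk3
    subst hst
    exact ⟨hkk, by rw [← h1, hk1]⟩
  have hlk : u (e 3) (e 2) = rest (Equiv.swap 1 2 s) := by
    rw [← hu.antipode, hkl, antipodeMap_rest]
  have hll : u (e 3) (e 3) = f 0 + f (Equiv.swap 1 2 s) := by
    have h₁ := hu.magic.row (e 3)
    rw [← Equiv.sum_comp e, Fin.sum_univ_four, hli, hlj, hlk] at h₁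
    have h₂ : ofMat (1 - rankOne s).transpose + ofMat (rankOne s).transpose = ofMat 1 := by
      refine Prod.ext (add_zero 0) ?_
      change (1 - rankOne s).transpose + (rankOne s).transpose = 1
      rw [← Matrix.transpose_add, sub_add_cancel, Matrix.transpose_one]
    rw [h₂, rest] at h₁
    rw [← sub_eq_zero, ← sub_eq_zero.mpr h₁]
    abel
  refine ⟨s, hs, e, ?_⟩
  refine Matrix.ext ?_
  simp [Fin.forall_fin_succ, transitiveFour, hii, hij, hik, hil, hji, hjj, hjk, hjl, hki, hkj, hkk,
    hkl, hli, hlj, hlk, hll]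

theorem transitiveFour_one : transitiveFour 1 2 = repU := by
  simp only [transitiveFour, repU, rankOne_one, rest_one, rest_two, Matrix.transpose_sub,
    Matrix.transpose_one]

/-- Exchanging the two halves of the points exchanges the parameters `1` and `2`, so `s = 2` gives
no new type. -/
theorem transitiveFour_two :
    transitiveFour 2 1 = repU.submatrix ![2, 3, 0, 1] ![2, 3, 0, 1] := by
  refine Matrix.ext ?_
  simp [Fin.forall_fin_succ, transitiveFour, repU, rankOne_two, rest_one, rest_two]

theorem transitiveFour_three : transitiveFour 3 3 = repW := by
  have h₁ : ofMat (Matrix.single 0 0 1) = E 0 0 := rfl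
  have h₂ : ofMat (1 - Matrix.single 0 0 1) = E 1 1 := by
    refine Prod.ext rfl (matrix_two_ext ?_ ?_ ?_ ?_) <;> simp [ofMat_snd]
  simp [transitiveFour, repW, rankOne_three, rest_three, h₁, h₂]

/-! ### Two-point representations and decomposition into transitive blocks -/

/-- Projections of Haar measure `1/2` whose value at the counit is `1`. -/
theorem haar_eq_half {a : KP} (ha : IsStarProjection a) (h0 : a.1 0 = 1) (h : 8 * haar a = 4) :
    a = f 0 + f 1 + f 2 + f 3 ∨ a.2 1 1 = 1 - a.2 0 0 ∧ ∃ s ≠ 0, a.1 = (f 0 + f s).1 := by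
  rw [haar_eq] at h
  rcases isStarProjection_snd ha with h₂ | h₂ | h₂
  · left
    refine KP.ext ?_ fun k l => ?_
    · rw [h₂] at h
      rcases isStarProjection_fst ha 1 with h1 | h1 <;>
      rcases isStarProjection_fst ha 2 with h2 | h2 <;>
      rcases isStarProjection_fst ha 3 with h3 | h3 <;> rw [h0, h1, h2, h3] at h <;> norm_num at h
      simp [Fin.forall_fin_succ, h0, h1, h2, h3]
    · rw [h₂]
      simp
  · exfalso
    rw [h₂] at h
    rcases isStarProjection_fst ha 1 with h1 | h1 <;>
    rcases isStarProjection_fst ha 2 with h2 | h2 <;>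
    rcases isStarProjection_fst ha 3 with h3 | h3 <;> rw [h0, h1, h2, h3] at h <;> norm_num at h
  · refine .inr ⟨h₂, exists_fst_eq ha h0 ?_⟩
    rw [h₂] at h
    linear_combination h

/-- Projections of Haar measure `1/8`. -/
theorem snd_eq_zero_of_haar {a : KP} (ha : IsStarProjection a) (h : 8 * haar a = 1) :
    a.2 = 0 := by
  rw [haar_eq] at h
  rcases isStarProjection_snd ha with h₂ | h₂ | h₂
  · exact h₂
  all_goals
    exfalso
    rw [h₂] at h
    rcases isStarProjection_fst ha 0 with h0 | h0 <;>
    rcases isStarProjection_fst ha 1 with h1 | h1 <;>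
    rcases isStarProjection_fst ha 2 with h2 | h2 <;>
    rcases isStarProjection_fst ha 3 with h3 | h3 <;>
      rw [h0, h1, h2, h3] at h <;> ring_nf at h <;> norm_num at h

open Complex (I)

namespace IsMagicRep

variable {V : Type*} [Fintype V] {u : Matrix V V KP}

/-- Everything is determined by one diagonal entry `q`. A commutative `q` gives `x`; otherwise its
`M₂(ℂ)` part has rank one and is symmetric by the antipode, which leaves only `y` and `z`. -/
theorem exists_equiv_of_card_eq_two (hu : IsMagicRep u) (h8 : ∀ i j, 8 * haar (u i j) = 4)
    (hV : Fintype.card V = 2) :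
        ∃ (t : BlockType) (e : Fin t.size ≃ V), u.submatrix e e = t.rep := by
  obtain ⟨e⟩ : Nonempty (Fin 2 ≃ V) := ⟨(Fintype.equivFinOfCardEq hV).symm⟩
  have h01 : u (e 0) (e 1) = 1 - u (e 0) (e 0) := by
    rw [← hu.magic.row (e 0), ← Equiv.sum_comp e, Fin.sum_univ_two, add_sub_cancel_left]
  have h10 : u (e 1) (e 0) = 1 - u (e 0) (e 0) := by
    rw [← hu.magic.col (e 0), ← Equiv.sum_comp e, Fin.sum_univ_two, add_sub_cancel_left]
  have h11 : u (e 1) (e 1) = u (e 0) (e 0) := by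
    have := hu.magic.row (e 1)
    rw [← Equiv.sum_comp e, Fin.sum_univ_two, h10] at this
    rw [← sub_eq_zero, ← sub_eq_zero.mpr this]
    abel
  have hsym : (u (e 0) (e 0)).2 1 0 = (u (e 0) (e 0)).2 0 1 := hu.snd_swap _ _ _ _
  have pair (k l m n : Fin 2) := hu.pairing_comulMap (matCoord k l) (matCoord m n) (e 0) (e 0)
  simp only [← Equiv.sum_comp e, Fin.sum_univ_two, h01, h10] at pair
  have hmat : u.submatrix e e =
      !![u (e 0) (e 0), 1 - u (e 0) (e 0); 1 - u (e 0) (e 0), u (e 0) (e 0)] := by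
    refine Matrix.ext ?_
    simp [Fin.forall_fin_succ, h01, h10, h11]
  have hproj := hu.magic.proj (e 0) (e 0)
  have hcounit := hu.counit_self (e 0)
  have hhaar := h8 (e 0) (e 0)
  generalize u (e 0) (e 0) = q at *
  rcases haar_eq_half hproj hcounit hhaar with hq | ⟨htr, s, hs, hq⟩
  · subst hq
    have : (1 : KP) - (f 0 + f 1 + f 2 + f 3) = ofMat 1 := by
      refine Prod.ext ?_ ?_
      · refine funext ?_
        simp [Fin.forall_fin_succ, KP.fst_sub, ofMat_fst]
      · simp [KP.snd_sub, ofMat_snd]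
    rw [this] at hmat
    exact ⟨.x, e, hmat⟩
  · have h₁ := pair 0 0 0 0
    have h₂ := pair 0 1 0 1
    have h₃ := pair 0 1 1 0
    have h₄ := pair 1 0 0 1
    rw [pairing_comulMap_diag, hq] at h₁
    rw [pairing_comulMap_offDiag, hq] at h₂
    rw [pairing_comulMap_upper_lower, hq] at h₃
    rw [pairing_comulMap_lower_upper, hq] at h₄
    simp only [matCoord_apply, KP.snd_sub, KP.snd_one, Matrix.sub_apply, Matrix.one_apply_eq, ne_eq,
      zero_ne_one, one_ne_zero, not_false_eq_true, Matrix.one_apply_ne, zero_sub, hsym]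
      at h₁ h₂ h₃ h₄
    have hP : q.2 = rankOne s ∨ q.2 = 1 - rankOne s :=
      eq_rankOne hs htr h₁.symm (by rw [h₂, hsym]; ring) (by rw [h₃]; ring)
        (by rw [h₄, hsym]; ring)
    -- By symmetry two of the extracted coefficients agree, but for `s = 1, 2` one is real and
    -- nonzero and the other purely imaginary.
    have h₅ := h₂.trans h₃.symm
    obtain rfl : s = 3 := by
      obtain rfl | rfl | rfl : s = 1 ∨ s = 2 ∨ s = 3 := by
        clear hP hq h₁ h₂ h₃ h₄ h₅; revert s; decide
      · have := congrArg Complex.re h₅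
        simp at this
      · have := congrArg Complex.re h₅
        simp at this
      · rfl
    rw [rankOne_three] at hP
    rcases hP with hP | hP
    · obtain rfl : q = f 0 + f 3 + E 0 0 :=
        Prod.ext (by rw [hq]; exact (add_zero _).symm) (by rw [hP]; simp)
      have : (1 : KP) - (f 0 + f 3 + E 0 0) = f 1 + f 2 + E 1 1 := by rw [one_eq]; abel
      rw [this] at hmat
      exact ⟨.y, e, hmat⟩
    · obtain rfl : q = f 0 + f 3 + E 1 1 :=
        Prod.ext (by rw [hq]; exact (add_zero _).symm)
          (by rw [hP]; refine matrix_two_ext ?_ ?_ ?_ ?_ <;> simp)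
      have : (1 : KP) - (f 0 + f 3 + E 1 1) = f 1 + f 2 + E 0 0 := by rw [one_eq]; abel
      rw [this] at hmat
      exact ⟨.z, e, hmat⟩

/-- The classification of the transitive magic representations. -/
theorem exists_equiv_of_transitive (hu : IsMagicRep u) [Nonempty V] (h : ∀ i j, u i j ≠ 0) :
    ∃ (t : BlockType) (e : Fin t.size ≃ V), u.submatrix e e = t.rep := by
  obtain ⟨i₀⟩ := ‹Nonempty V›
  obtain ⟨m, hm0, hm8, hm⟩ := haar_eq_natCast (hu.magic.proj i₀ i₀) (hu.counit_self i₀)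
  have hnm : Fintype.card V * m = 8 := by
    have := hu.card_mul_haar h i₀ i₀
    exact_mod_cast (show (Fintype.card V : ℂ) * m = 8 by rw [← hm]; linear_combination 8 * this)
  have h8 : ∀ i j, 8 * haar (u i j) = m := fun i j => by
    have h₁ := hu.card_mul_haar h i j
    have h₂ : (Fintype.card V : ℂ) * m = 8 := by exact_mod_cast hnm
    have h₃ : (Fintype.card V : ℂ) ≠ 0 := fun h0 => by simp [h0] at h₁
    refine mul_left_cancel₀ h₃ ?_
    rw [h₂]
    linear_combination 8 * h₁
  have hcases : m = 8 ∧ Fintype.card V = 1 ∨ m = 4 ∧ Fintype.card V = 2 ∨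
      m = 2 ∧ Fintype.card V = 4 ∨ m = 1 := by
    interval_cases m <;> omega
  rcases hcases with ⟨-, hV⟩ | ⟨rfl, hV⟩ | ⟨rfl, hV⟩ | rfl
  · obtain ⟨e⟩ : Nonempty (Fin 1 ≃ V) := ⟨(Fintype.equivFinOfCardEq hV).symm⟩
    have := hu.magic.row (e 0)
    rw [← Equiv.sum_comp e, Fin.sum_univ_one] at this
    have hmat : u.submatrix e e = 1 := by
      refine Matrix.ext ?_
      simpa [Fin.forall_fin_one] using this
    exact ⟨.one, e, hmat⟩
  · exact hu.exists_equiv_of_card_eq_two (by exact_mod_cast h8) hV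
  · obtain ⟨s, hs, e, he⟩ := hu.exists_equiv_of_card_eq_four (by exact_mod_cast h8) hV
    obtain rfl | rfl | rfl : s = 1 ∨ s = 2 ∨ s = 3 := by clear he; revert s; decide
    · exact ⟨.u, e, he.trans transitiveFour_one⟩
    -- Composing the labelling with the exchange of the two halves undoes the one in
    -- `transitiveFour_two`.
    · let σ : Equiv.Perm (Fin 4) := Equiv.swap 0 2 * Equiv.swap 1 3
      have hσ : ∀ x, ![2, 3, 0, 1] (σ x) = x := by decide
      have hmat : u.submatrix (σ.trans e) (σ.trans e) = repU := by
        refine Matrix.ext fun x y => ?_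
        have := congrFun (congrFun (he.trans transitiveFour_two) (σ x)) (σ y)
        rw [Matrix.submatrix_apply repU, hσ, hσ] at this
        exact this
      exact ⟨.u, σ.trans e, hmat⟩
    · exact ⟨.w, e, he.trans transitiveFour_three⟩
  -- On eight points all entries have measure `1/8` and vanish on `M₂(ℂ)`, so a row could not sum to
  -- `1`.
  · exfalso
    have h₁ := congrArg (matCoord 0 0) (hu.magic.row i₀)
    rw [map_sum, Finset.sum_eq_zero] at h₁
    · exact zero_ne_one h₁
    · intro j _
      rw [matCoord_apply, snd_eq_zero_of_haar (hu.magic.proj i₀ j) (by exact_mod_cast h8 i₀ j)]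
      rfl

/-- The fibres of `c` are the orbits: each restricts to a transitive representation, and entries
between different orbits are zero. -/
theorem nonempty_blockLabelling (hu : IsMagicRep u) : Nonempty (BlockLabelling u) := by
  classical
  let r : Setoid V := hu.orbitSetoid
  let c : V → Fin (Fintype.card (Quotient r)) := fun v => Fintype.equivFin _ (Quotient.mk r v)
  have hc : ∀ i j, c i = c j ↔ u i j ≠ 0 := fun i j =>
    (Fintype.equivFin _).injective.eq_iff.trans Quotient.eq
  have key : ∀ q, ∃ (t : BlockType) (e : Fin t.size ≃ {v // c v = q}),
      u.submatrix (fun x => (e x : V)) (fun x => (e x : V)) = t.rep := by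
    intro q
    have : Nonempty {v // c v = q} := by
      obtain ⟨v, hv⟩ := Quotient.exists_rep ((Fintype.equivFin (Quotient r)).symm q)
      exact ⟨v, by rw [Equiv.eq_symm_apply] at hv; exact hv⟩
    have hO := hu.submatrix_orbit (Subtype.val : {v // c v = q} → V) Subtype.val_injective
      fun a i => by
        rw [← hc, a.2, Subtype.range_coe_subtype]
        exact eq_comm
    obtain ⟨t, e, he⟩ := hO.exists_equiv_of_transitive fun a b => (hc _ _).mp (a.2.trans b.2.symm)
    exact ⟨t, e, he⟩
  choose t e he using key
  refine ⟨⟨_, t, (Equiv.sigmaFiberEquiv c).symm.trans (Equiv.sigmaCongrRight fun q => (e q).symm),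
    Matrix.ext fun i j => ?_⟩⟩
  by_cases hij : c i = c j
  · have hlabel : ∀ (q) (v : {v // c v = q}), ((Equiv.sigmaFiberEquiv c).symm.trans
        (Equiv.sigmaCongrRight fun q => (e q).symm)) v = ⟨q, (e q).symm v⟩ := by
      rintro _ ⟨v, rfl⟩
      rfl
    rw [Matrix.submatrix_apply, hlabel (c j) ⟨i, hij⟩, hlabel (c j) ⟨j, rfl⟩,
      Matrix.blockDiagonal'_apply_eq, ← he]
    simp
  · rw [Matrix.submatrix_apply]
    refine .trans ?_ (Matrix.blockDiagonal'_apply_ne _ _ _ hij).symm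
    exact not_not.mp (mt (hc i j).mpr hij)

end IsMagicRep

/-! ### Orthonormal coordinates -/

/-- The element of `C(G₀)` with given integer coordinates in an orthonormal basis for the inner
product `8 h(a b)`, adapted to the entries of the transitive magic representations. -/
def ofCoords (a : Fin 8 → ℤ) : KP :=
  (![(a 0 + a 1 + a 2 + a 3) / 2, (a 0 + a 1 - a 2 - a 3) / 2, (a 0 - a 1 + a 2 - a 3) / 2,
      (a 0 - a 1 - a 2 + a 3) / 2],
    !![(a 4 + a 7) / 2, a 5 * p 0 1 + a 6 * p 1 0; a 5 * p 1 0 + a 6 * p 0 1, (a 4 - a 7) / 2])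

theorem ofCoords_fst (a : Fin 8 → ℤ) : (ofCoords a).1 =
    (![(a 0 + a 1 + a 2 + a 3) / 2, (a 0 + a 1 - a 2 - a 3) / 2, (a 0 - a 1 + a 2 - a 3) / 2,
      (a 0 - a 1 - a 2 + a 3) / 2] : Fin 4 → ℂ) := rfl

theorem ofCoords_snd (a : Fin 8 → ℤ) : (ofCoords a).2 =
    (!![(a 4 + a 7) / 2, a 5 * p 0 1 + a 6 * p 1 0;
      a 5 * p 1 0 + a 6 * p 0 1, (a 4 - a 7) / 2] : Matrix (Fin 2) (Fin 2) ℂ) := rfl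

/-- Coordinates `5` and `6` are orthogonal because `p 0 1 ^ 2 + p 1 0 ^ 2 = 0`. With integer
coordinates, the effect of `D₄` on the blocks becomes a finite, decidable check. -/
theorem haar_ofCoords_mul_ofCoords (a b : Fin 8 → ℤ) :
    8 * haar (ofCoords a * ofCoords b) = (∑ i, a i * b i : ℤ) := by
  rw [haar_eq]
  simp only [KP.fst_mul, KP.snd_mul, Pi.mul_apply, Matrix.mul_apply, Fin.sum_univ_two,
    ofCoords_fst, ofCoords_snd, Matrix.of_apply, Matrix.cons_val, Fin.sum_univ_eight]
  push_cast
  linear_combination (4 * (a 5 * b 5 + a 6 * b 6 : ℂ)) * p_upper_mul_lower +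
    2 * (a 5 * b 6 + a 6 * b 5 : ℂ) * (p_upper_sq + p_lower_sq)

/-- The coordinates of the entries of the transitive magic representations. -/
def BlockType.coords : (t : BlockType) → Matrix (Fin t.size) (Fin t.size) (Fin 8 → ℤ)
  | .u => !![![1, 1, 0, 0, 0, 0, 0, 0], ![1, -1, 0, 0, 0, 0, 0, 0],
        ![0, 0, 0, 0, 1, 1, 0, 0], ![0, 0, 0, 0, 1, -1, 0, 0];
      ![1, -1, 0, 0, 0, 0, 0, 0], ![1, 1, 0, 0, 0, 0, 0, 0],
        ![0, 0, 0, 0, 1, -1, 0, 0], ![0, 0, 0, 0, 1, 1, 0, 0];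
      ![0, 0, 0, 0, 1, 0, 1, 0], ![0, 0, 0, 0, 1, 0, -1, 0],
        ![1, 0, 1, 0, 0, 0, 0, 0], ![1, 0, -1, 0, 0, 0, 0, 0];
      ![0, 0, 0, 0, 1, 0, -1, 0], ![0, 0, 0, 0, 1, 0, 1, 0],
        ![1, 0, -1, 0, 0, 0, 0, 0], ![1, 0, 1, 0, 0, 0, 0, 0]]
  | .w => !![![1, 0, 0, 1, 0, 0, 0, 0], ![1, 0, 0, -1, 0, 0, 0, 0],
        ![0, 0, 0, 0, 1, 0, 0, 1], ![0, 0, 0, 0, 1, 0, 0, -1];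
      ![1, 0, 0, -1, 0, 0, 0, 0], ![1, 0, 0, 1, 0, 0, 0, 0],
        ![0, 0, 0, 0, 1, 0, 0, -1], ![0, 0, 0, 0, 1, 0, 0, 1];
      ![0, 0, 0, 0, 1, 0, 0, 1], ![0, 0, 0, 0, 1, 0, 0, -1],
        ![1, 0, 0, 1, 0, 0, 0, 0], ![1, 0, 0, -1, 0, 0, 0, 0];
      ![0, 0, 0, 0, 1, 0, 0, -1], ![0, 0, 0, 0, 1, 0, 0, 1],
        ![1, 0, 0, -1, 0, 0, 0, 0], ![1, 0, 0, 1, 0, 0, 0, 0]]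
  | .x => !![![2, 0, 0, 0, 0, 0, 0, 0], ![0, 0, 0, 0, 2, 0, 0, 0];
      ![0, 0, 0, 0, 2, 0, 0, 0], ![2, 0, 0, 0, 0, 0, 0, 0]]
  | .y => !![![1, 0, 0, 1, 1, 0, 0, 1], ![1, 0, 0, -1, 1, 0, 0, -1];
      ![1, 0, 0, -1, 1, 0, 0, -1], ![1, 0, 0, 1, 1, 0, 0, 1]]
  | .z => !![![1, 0, 0, 1, 1, 0, 0, -1], ![1, 0, 0, -1, 1, 0, 0, 1];
      ![1, 0, 0, -1, 1, 0, 0, 1], ![1, 0, 0, 1, 1, 0, 0, -1]]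
  | .one => !![![2, 0, 0, 0, 2, 0, 0, 0]]

theorem KP.ext_coords {a b : KP} (h : a.1 0 = b.1 0 ∧ a.1 1 = b.1 1 ∧ a.1 2 = b.1 2 ∧
    a.1 3 = b.1 3 ∧
    a.2 0 0 = b.2 0 0 ∧ a.2 0 1 = b.2 0 1 ∧ a.2 1 0 = b.2 1 0 ∧ a.2 1 1 = b.2 1 1) : a = b := by
  obtain ⟨h0, h1, h2, h3, h00, h01, h10, h11⟩ := h
  refine Prod.ext (funext fun i => ?_) (matrix_two_ext h00 h01 h10 h11)
  fin_cases i <;> assumption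

theorem BlockType.rep_eq_ofCoords : ∀ (t : BlockType) (x y : Fin t.size),
    t.rep x y = ofCoords (t.coords x y)
  | .u => by
    change ∀ x y : Fin 4, repU x y = ofCoords _
    intro x y
    fin_cases x <;> fin_cases y <;> refine KP.ext_coords ?_ <;>
      simp [repU, ofCoords_fst, ofCoords_snd, BlockType.coords, ofMat_fst, ofMat_snd,
        p_upper_left, p_lower_right] <;> norm_num
  | .w => by
    change ∀ x y : Fin 4, repW x y = ofCoords _
    intro x y
    fin_cases x <;> fin_cases y <;> refine KP.ext_coords ?_ <;>
      simp [repW, ofCoords_fst, ofCoords_snd, BlockType.coords]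
  | .x => by
    change ∀ x y : Fin 2, repX x y = ofCoords _
    intro x y
    fin_cases x <;> fin_cases y <;> refine KP.ext_coords ?_ <;>
      simp [repX, ofCoords_fst, ofCoords_snd, BlockType.coords, ofMat_fst, ofMat_snd]
  | .y => by
    change ∀ x y : Fin 2, repY x y = ofCoords _
    intro x y
    fin_cases x <;> fin_cases y <;> refine KP.ext_coords ?_ <;>
      simp [repY, ofCoords_fst, ofCoords_snd, BlockType.coords]
  | .z => by
    change ∀ x y : Fin 2, repZ x y = ofCoords _
    intro x y
    fin_cases x <;> fin_cases y <;> refine KP.ext_coords ?_ <;>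
      simp [repZ, ofCoords_fst, ofCoords_snd, BlockType.coords]
  | .one => by
    change ∀ x y : Fin 1, (1 : Matrix (Fin 1) (Fin 1) KP) x y = ofCoords _
    intro x y
    fin_cases x; fin_cases y
    refine KP.ext_coords ?_
    simp [ofCoords_fst, ofCoords_snd, BlockType.coords]

end

/-! ### Invariance of the orbitals -/

/-- `ω` acts on the columns of all blocks through one isometry of the coordinates. -/
def ActsIsometrically (ω : D4) : Prop :=
  ∃ T : (Fin 8 → ℤ) → (Fin 8 → ℤ), (∀ a b, ∑ i, T a i * T b i = ∑ i, a i * b i) ∧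
    ∀ (t : BlockType) (x y : Fin t.size), t.coords x (t.action ω y) = T (t.coords x y)

theorem ActsIsometrically.one : ActsIsometrically 1 :=
  ⟨id, fun _ _ => rfl, fun t x y => by rw [map_one]; rfl⟩

theorem ActsIsometrically.mul {ω η : D4} (hω : ActsIsometrically ω) (hη : ActsIsometrically η) :
    ActsIsometrically (ω * η) := by
  obtain ⟨T, hT, h⟩ := hω
  obtain ⟨T', hT', h'⟩ := hη
  refine ⟨T ∘ T', fun a b => (hT _ _).trans (hT' _ _), fun t x y => ?_⟩
  rw [map_mul, Equiv.Perm.mul_apply, h, h']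
  rfl

/-- The transposition `(12)`. -/
def flip : D4 := ⟨Equiv.swap 0 1, by change _ ∈ d4List; decide⟩

/-- The permutation `(13)(24)`. -/
def cross : D4 := ⟨Equiv.swap 0 2 * Equiv.swap 1 3, by change _ ∈ d4List; decide⟩

/-- Exchanging the first two columns of `u` changes the sign of coordinate `1` in the upper rows and
of coordinate `6` in the lower ones. Both coordinates vanish on all other types, where `flip` acts
trivially. -/
theorem actsIsometrically_flip : ActsIsometrically flip := by
  refine ⟨fun a => ![a 0, -a 1, a 2, a 3, a 4, a 5, -a 6, a 7], fun a b => ?_, ?_⟩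
  · simp [Fin.sum_univ_eight]
  · rintro (_ | _ | _ | _ | _ | _) <;> decide

/-- The isometry exchanges the coordinates of the commutative summand with those of `M₂(ℂ)`. It
fixes the entries of `y` but exchanges those in each row of `z`, which is why `D₄` acts differently
on these two types. -/
theorem actsIsometrically_cross : ActsIsometrically cross := by
  refine ⟨fun a => ![a 4, a 5, a 6, a 7, a 0, a 1, a 2, a 3], fun a b => ?_, ?_⟩
  · simp [Fin.sum_univ_eight]
    ring
  · rintro (_ | _ | _ | _ | _ | _) <;> decide

theorem actsIsometrically (ω : D4) : ActsIsometrically ω := by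
  -- `flip` and `cross` generate `D₄`, and alternating words of length at most four suffice.
  have gen : ∀ ω ∈ d4List, ∃ a b c d : Bool, ω =
      (if a then flip.1 else 1) * (if b then cross.1 else 1) * (if c then flip.1 else 1) *
        (if d then cross.1 else 1) := by decide
  have key : ∀ (b : Bool) {ω : D4},
      ActsIsometrically ω → ActsIsometrically (if b then ω else 1) := by
    rintro (_ | _) ω hω
    · exact .one
    · exact hω
  obtain ⟨a, b, c, d, h⟩ := gen ω.1 ω.2
  have : ω = (if a then flip else 1) * (if b then cross else 1) * (if c then flip else 1) *
      (if d then cross else 1) := by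
    refine Subtype.ext (h.trans ?_)
    cases a <;> cases b <;> cases c <;> cases d <;> rfl
  rw [this]
  exact ((((key a actsIsometrically_flip).mul (key b actsIsometrically_cross)).mul
    (key c actsIsometrically_flip)).mul (key d actsIsometrically_cross))

/-- The action preserves blocks, so a column move stays in the same row of the same block or among
the zero entries off the diagonal blocks. -/
theorem BlockLabelling.apply_action {V : Type*} {u : Matrix V V KP} (L : BlockLabelling u)
    (ω : D4) (i j : V) : (u i j = 0 ∧ u i (L.action ω j) = 0) ∨
      ∃ (t : BlockType) (x y : Fin t.size),
        u i j = t.rep x y ∧ u i (L.action ω j) = t.rep x (t.action ω y) := by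
  have hlabel : L.label (L.action ω j) =
      ⟨(L.label j).1, (L.type (L.label j).1).action ω (L.label j).2⟩ :=
    L.label.apply_symm_apply _
  have hu (k : V) : u i k = Matrix.blockDiagonal' (fun q => (L.type q).rep) (L.label i) (L.label k) :=
    congrFun (congrFun L.eq_blockDiagonal i) k
  rw [hu, hu, hlabel]
  rcases L.label i with ⟨q, x⟩
  rcases L.label j with ⟨q', y⟩
  by_cases h : q = q'
  · subst h
    exact .inr ⟨L.type q, x, y, Matrix.blockDiagonal'_apply_eq _ _ _ _,
      Matrix.blockDiagonal'_apply_eq _ _ _ _⟩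
  · exact .inl ⟨Matrix.blockDiagonal'_apply_ne _ _ _ h, Matrix.blockDiagonal'_apply_ne _ _ _ h⟩

/-- The action of `D4` preserves the orbital relation. -/
theorem BlockLabelling.mul_action_eq_zero_iff {V : Type*} [Fintype V] {u : Matrix V V KP}
    (hu : IsMagic u) (L : BlockLabelling u) (ω : D4) (i j k l : V) :
    u i (L.action ω j) * u k (L.action ω l) = 0 ↔ u i j * u k l = 0 := by
  obtain ⟨T, hT, h⟩ := actsIsometrically ω
  rcases L.apply_action ω i j with ⟨h₁, h₂⟩ | ⟨t, x, y, h₁, h₂⟩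
  · simp [h₁, h₂]
  rcases L.apply_action ω k l with ⟨h₃, h₄⟩ | ⟨t', x', y', h₃, h₄⟩
  · simp [h₃, h₄]
  -- The two entries may lie in blocks of different types; the same `T` serves both, so their inner
  -- product is unchanged.
  rw [mul_eq_zero_iff_haar (hu.proj _ _) (hu.proj _ _),
    mul_eq_zero_iff_haar (hu.proj _ _) (hu.proj _ _), h₁, h₂, h₃, h₄]
  simp only [BlockType.rep_eq_ofCoords, h]
  rw [← mul_right_inj' (show (8 : ℂ) ≠ 0 by norm_num), haar_ofCoords_mul_ofCoords, hT,
    ← haar_ofCoords_mul_ofCoords, mul_right_inj' (by norm_num)]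

theorem BlockLabelling.image_orbital {V : Type*} [Fintype V] {u : Matrix V V KP}
    (hu : IsMagic u) (L : BlockLabelling u) (ω : D4) {o : Set (V × V)} (ho : IsOrbital u o) :
    Prod.map (L.action ω) (L.action ω) '' o = o := by
  obtain ⟨a, rfl⟩ := ho
  ext b
  constructor
  · rintro ⟨c, hc, rfl⟩
    exact (L.mul_action_eq_zero_iff hu ω _ _ _ _).not.mpr hc
  · intro hb
    refine ⟨Prod.map (L.action ω).symm (L.action ω).symm b, ?_, ?_⟩
    swap
    · exact Prod.ext (Equiv.apply_symm_apply _ _) (Equiv.apply_symm_apply _ _)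
    change _ ≠ _
    rw [Ne, ← L.mul_action_eq_zero_iff hu ω]
    simp only [Prod.map_fst, Prod.map_snd, Equiv.apply_symm_apply]
    exact hb

/-! ### Adjacency and orbitals -/

theorem preserves_iff {V : Type*} [Fintype V] {A : Type*} [Ring A] (u : Matrix V V A)
    (X : SimpleGraph V) : Preserves u X ↔ ∀ i j,
      (open Classical in ∑ k with X.Adj i k, u k j) = open Classical in ∑ k with X.Adj k j,
          u i k := by
  classical
  rw [Preserves, ← Matrix.ext_iff]
  refine forall₂_congr fun i j => ?_
  simp only [Matrix.mul_apply, SimpleGraph.adjMatrix_apply, ite_mul, mul_ite, one_mul, mul_one,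
    zero_mul, mul_zero, Finset.sum_filter]

/-- Sandwich the `(i, l)` entry of `du = ud` between `u i j` and `u k l`: orthogonality leaves the
single index `k` on the left side and `j` on the right side, so `d_ik u_ij u_kl = d_jl u_ij u_kl`.
-/
theorem IsMagicRep.adj_iff {V : Type*} [Fintype V] {u : Matrix V V KP} (hu : IsMagicRep u)
    {X : SimpleGraph V} (hX : Preserves u X) {i j k l : V} (h : u i j * u k l ≠ 0) :
    X.Adj i k ↔ X.Adj j l := by
  classical
  have h₁ := (preserves_iff u X).mp hX i l
  have h₂ := congrArg (fun t => u i j * t * u k l) h₁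
  simp only [Finset.sum_filter, Finset.mul_sum, Finset.sum_mul] at h₂
  rw [Finset.sum_eq_single k, Finset.sum_eq_single j] at h₂
  · by_cases hik : X.Adj i k <;> by_cases hjl : X.Adj j l <;>
      simp [hik, hjl, mul_assoc, (hu.magic.proj _ _).isIdempotentElem.eq] at h₂ ⊢
    · exact h h₂
    · exact h h₂.symm
  · intro m _ hm
    split_ifs
    · rw [hu.row_orthogonal i hm.symm, zero_mul]
    · simp
  · simp
  · intro m _ hm
    split_ifs
    · rw [mul_assoc, hu.col_orthogonal l hm, mul_zero]
    · simp
  · simp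

/-- The pair `(i, j)` and its image lie in one orbital, because `u i i * u j j` has counit `1` and
is therefore nonzero. -/
theorem IsMagicRep.adj_action_iff {V : Type*} [Fintype V] {u : Matrix V V KP}
    (hu : IsMagicRep u) (L : BlockLabelling u) {X : SimpleGraph V} (hX : Preserves u X)
    (ω : D4) (i j : V) : X.Adj (L.action ω i) (L.action ω j) ↔ X.Adj i j := by
  refine (hu.adj_iff hX ?_).symm
  rw [Ne, L.mul_action_eq_zero_iff hu.magic]
  intro h
  have h0 : (u i i).1 0 * (u j j).1 0 = 0 := congrFun (congrArg Prod.fst h) 0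
  rw [hu.counit_self, hu.counit_self, mul_one] at h0
  exact one_ne_zero h0

/-! ### Occurrence of a block of type `u` and faithfulness of the action -/

theorem BlockLabelling.action_injective {V : Type*} {u : Matrix V V KP} (L : BlockLabelling u)
    (h : ∃ q, L.type q = BlockType.u) : Function.Injective L.action := by
  obtain ⟨q, hq⟩ := h
  intro ω η hωη
  have h₁ : ∀ x : Fin (L.type q).size, (L.type q).action ω x = (L.type q).action η x := fun x => by
    have := congrArg (fun π : Equiv.Perm V => L.label (π (L.label.symm ⟨q, x⟩))) hωη
    simpa [BlockLabelling.action] using this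
  rw [hq] at h₁
  exact Subtype.ext (Equiv.ext h₁)

/-- The functions on `G₀` which agree at the points `0` and `3` of the classical version. -/
def agreeSubalgebra : StarSubalgebra ℂ KP where
  carrier := {a | a.1 0 = a.1 3}
  mul_mem' {a b} ha hb := by
    change a.1 0 * b.1 0 = a.1 3 * b.1 3
    rw [show a.1 0 = a.1 3 from ha, show b.1 0 = b.1 3 from hb]
  add_mem' {a b} ha hb := by
    change a.1 0 + b.1 0 = a.1 3 + b.1 3
    rw [show a.1 0 = a.1 3 from ha, show b.1 0 = b.1 3 from hb]
  algebraMap_mem' _ := rfl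
  star_mem' {a} ha := congrArg star (show a.1 0 = a.1 3 from ha)

/-- The values at the points `0` and `3` differ by the sum of coordinates `1` and `2`, which are
used by type `u` only. -/
theorem rep_mem_agreeSubalgebra {t : BlockType} (ht : t ≠ .u) (x y : Fin t.size) :
    t.rep x y ∈ agreeSubalgebra := by
  change (t.rep x y).1 0 = (t.rep x y).1 3
  have h : t.coords x y 1 = 0 ∧ t.coords x y 2 = 0 := by
    revert x y
    cases t
    · exact absurd rfl ht
    all_goals decide
  rw [BlockType.rep_eq_ofCoords, ofCoords_fst]
  simp [h.1, h.2]

/-- Without such a block the entries would generate a subalgebra of `agreeSubalgebra`, which misses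
`f 0`. -/
theorem BlockLabelling.exists_type_eq_u {V : Type*} {u : Matrix V V KP} (L : BlockLabelling u)
    (h : StarAlgebra.adjoin ℂ (entries u) = ⊤) : ∃ q, L.type q = BlockType.u := by
  by_contra! hL
  have hle : StarAlgebra.adjoin ℂ (entries u) ≤ agreeSubalgebra := by
    refine StarAlgebra.adjoin_le ?_
    rintro _ ⟨⟨i, j⟩, rfl⟩
    change u i j ∈ agreeSubalgebra
    rw [show u i j = Matrix.blockDiagonal' (fun q => (L.type q).rep) (L.label i) (L.label j) from
      congrFun (congrFun L.eq_blockDiagonal i) j]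
    rcases L.label i with ⟨q, x⟩
    rcases L.label j with ⟨q', y⟩
    by_cases h : q = q'
    · subst h
      rw [Matrix.blockDiagonal'_apply_eq]
      exact rep_mem_agreeSubalgebra (hL q) x y
    · rw [Matrix.blockDiagonal'_apply_ne _ _ _ h]
      exact zero_mem _
  rw [h] at hle
  have h0 : (f 0).1 0 = (f 0).1 3 := hle (StarSubalgebra.mem_top (x := f 0))
  rw [f_fst_apply, f_fst_apply] at h0
  simp at h0

/-! ### The quantum automorphism group of a graph -/

theorem isMagic_permMatrix {V : Type*} [Fintype V] [DecidableEq V] (σ : Equiv.Perm V) :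
    IsMagic (Matrix.of fun i j => if i = σ j then (1 : ℂ) else 0) where
  proj i j := by
    rw [Matrix.of_apply]
    split_ifs
    · exact .one _
    · exact .zero _
  row i := by
    simp only [Matrix.of_apply, ← Equiv.symm_apply_eq]
    simp
  col j := by simp

theorem preserves_permMatrix {V : Type*} [Fintype V] [DecidableEq V] {X : SimpleGraph V}
    {σ : Equiv.Perm V} (hσ : ∀ i j, X.Adj (σ i) (σ j) ↔ X.Adj i j) :
    Preserves (Matrix.of fun i j => if i = σ j then (1 : ℂ) else 0) X := by
  classical
  rw [preserves_iff]
  intro i j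
  simp only [Matrix.of_apply, Finset.sum_ite_eq, Finset.sum_filter, ← Equiv.symm_apply_eq]
  rw [Finset.sum_eq_single (σ j)]
  · have := hσ (σ.symm i) j
    rw [Equiv.apply_symm_apply] at this
    simp [this]
  · intro k _ hk
    simp [Equiv.symm_apply_eq, hk]
  · simp

/-- The relation `du = ud` is linear in the entries, so it is carried along the isomorphism. -/
theorem preserves_of_sameWoronowicz {N : ℕ} {X : SimpleGraph (Fin N)}
    {v : Matrix (Fin N) (Fin N) KP} (h : SameWoronowicz (fund X) v) : Preserves v X := by
  classical
  obtain ⟨φ, hφ⟩ := h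
  let U : Fin N → Fin N → StarAlgebra.adjoin ℂ (entries (fund X)) := fun i j =>
    ⟨fund X i j, StarAlgebra.subset_adjoin ℂ _ ⟨(i, j), rfl⟩⟩
  have hU : ∀ i j, ∑ k with X.Adj i k, U k j = ∑ k with X.Adj k j, U i k := fun i j => by
    refine Subtype.ext ?_
    rw [AddSubmonoidClass.coe_finsetSum, AddSubmonoidClass.coe_finsetSum]
    exact (preserves_iff _ X).mp (fund_preserves X) i j
  refine (preserves_iff v X).mpr fun i j => ?_
  have := congrArg (fun t => (φ t : KP)) (hU i j)
  simp only [map_sum, AddSubmonoidClass.coe_finsetSum] at this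
  simp only [← hφ]
  exact this

/-- The permutation matrix of an automorphism is a complex magic matrix commuting with `d`. The
universal property of `C(G⁺(X))` makes it a character, transported to `C(G₀)` by the identification.
-/
theorem exists_algHom_of_sameWoronowicz {N : ℕ} {X : SimpleGraph (Fin N)}
    {v : Matrix (Fin N) (Fin N) KP} (hv : StarAlgebra.adjoin ℂ (entries v) = ⊤)
    (h : SameWoronowicz (fund X) v) {σ : Equiv.Perm (Fin N)}
    (hσ : ∀ i j, X.Adj (σ i) (σ j) ↔ X.Adj i j) :
    ∃ χ : KP →ₐ[ℂ] ℂ, ∀ i j, χ (v i j) = if i = σ j then 1 else 0 := by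
  obtain ⟨φ, hφ⟩ := h
  obtain ⟨ψ, hψ, -⟩ := existsUnique_hom X ℂ _ (isMagic_permMatrix σ) (preserves_permMatrix hσ)
  let ι : KP →⋆ₐ[ℂ] StarAlgebra.adjoin ℂ (entries v) :=
    (StarAlgHom.id ℂ KP).codRestrict _ fun a => by rw [hv]; exact StarSubalgebra.mem_top
  let χ : KP →⋆ₐ[ℂ] ℂ :=
    (ψ.comp (StarSubalgebra.subtype _)).comp ((StarAlgHomClass.toStarAlgHom φ.symm).comp ι)
  refine ⟨χ.toAlgHom, fun i j => ?_⟩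
  have h₁ : φ.symm (ι (v i j)) = ⟨fund X i j, StarAlgebra.subset_adjoin ℂ _ ⟨(i, j), rfl⟩⟩ := by
    rw [StarAlgEquiv.symm_apply_eq]
    exact Subtype.ext (hφ i j).symm
  change ψ (φ.symm (ι (v i j)) : QAutAlg X) = _
  rw [h₁]
  exact hψ i j

theorem natCard_d4 : Nat.card D4 = 8 := by
  obtain ⟨e⟩ := nonempty_d4_mulEquiv_dihedralGroup
  rw [Nat.card_congr e.toEquiv, DihedralGroup.nat_card]

theorem not_hasFruchtProperty : ¬ HasFruchtProperty KP := by
  rintro ⟨N, X, v, hv, hXv⟩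
  have hu : IsMagicRep v := ⟨hv.magic, hv.comul⟩
  obtain ⟨L⟩ := hu.nonempty_blockLabelling
  have hX := preserves_of_sameWoronowicz hXv
  have key (ω : D4) := exists_algHom_of_sameWoronowicz hv.generates hXv (hu.adj_action_iff L hX ω)
  choose χ hχ using key
  -- The values of `χ ω` on the entries of `v` recover the permutation matrix of `ω`.
  have hinj : Function.Injective χ := fun ω η h => by
    refine L.action_injective (L.exists_type_eq_u hv.generates) (Equiv.ext fun j => ?_)
    have := hχ ω (L.action ω j) j
    rw [h, hχ, if_pos rfl] at this
    by_contra hne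
    rw [if_neg hne] at this
    exact zero_ne_one this
  have hcard : Nat.card (KP →ₐ[ℂ] ℂ) = 4 := by
    rw [← natCard_classicalVersion, Nat.card_congr (WithConv.equiv _)]
  have : Finite (KP →ₐ[ℂ] ℂ) := Nat.finite_of_card_ne_zero (by omega)
  have hle := Nat.card_le_card_of_injective χ hinj
  rw [natCard_d4, hcard] at hle
  omega

end KacPaljutkin

open QuantumAut KacPaljutkin in
theorem mainTheorem1 :
    -- there is no finite graph `X` with `G⁺(X) = G₀`
    ¬ HasFruchtProperty KP ∧
    -- for every embedding `G₀ ⊂ S_N⁺`, an explicit copy of `D₄` preserves every orbital, and is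
    -- contained in `G(X)` for every graph `X` on which `G₀` acts
    Nonempty (D4 ≃* DihedralGroup 4) ∧
    (∀ (N : ℕ) (u : Matrix (Fin N) (Fin N) KP), IsFundamentalMagicRep u →
      ∃ L : BlockLabelling u,
        (∃ q, L.type q = BlockType.u) ∧
        Function.Injective L.action ∧
        (∀ (ω : D4) (o : Set (Fin N × Fin N)), IsOrbital u o →
          Prod.map (L.action ω) (L.action ω) '' o = o) ∧
        ∀ X : SimpleGraph (Fin N), Preserves u X →
          ∀ (ω : D4) (i j : Fin N), X.Adj (L.action ω i) (L.action ω j) ↔ X.Adj i j) ∧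
    -- the classical version of `G₀` is `ℤ₂ × ℤ₂`
    Nonempty (ClassicalVersion KP ≃* Multiplicative (ZMod 2 × ZMod 2)) := by

  refine ⟨not_hasFruchtProperty, nonempty_d4_mulEquiv_dihedralGroup, fun N u h => ?_,
    nonempty_classicalVersion_mulEquiv⟩
  have hu : IsMagicRep u := ⟨h.magic, h.comul⟩
  obtain ⟨L⟩ := hu.nonempty_blockLabelling
  have hL := L.exists_type_eq_u h.generates
  exact ⟨L, hL, L.action_injective hL, fun ω o ho => L.image_orbital hu.magic ω ho,
    fun X hX ω i j => hu.adj_action_iff L hX ω i j⟩
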